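/- Let $M\in\mathbb R^{d\times d}$ be invertible, let $\Lambda=M\mathbb Z^d$, $\Lambda^*=M^{-T}\mathbb Z^d$ and $\Pi_\Lambda=M[0,1)^d$. Write $e_l(x)=e^{2\pi i\,l\cdot x}$. Let $\Omega\subset\mathbb R^d$ be a $k$-tile for $\Lambda$, i.e. a Lebesgue measurable set with $0<|\Omega|<\infty$ and $\sum_{l\in\Lambda}\chi_\Omega(x-l)=k$ for almost every $x\in\mathbb R^d$. For $x\in\Pi_\Lambda$ put $\Lambda_x=\{\lambda\in\Lambda: x+\lambda\in\Omega\}$. *Tree of a set.* For a set $S\subset\mathbb R^d$ and $0\le l\le d$ let $\mathcal M^l=\mathcal M^l(S)$ be the set of initial segments $(m_1,\dots,m_l)$ of vectors $m\in S$ (so $\mathcal M^0$ consists of the empty segment if $S\neq\emptyset$), and for $1\le l\le d$ and $p\in\mathcal M^{l-1}$ let $\mathcal Z^l_p=\{z\in\mathbb R:(p,z)\in\mathcal M^l\}$. *Perfect admissibility.* $\Omega$ is perfectly admissible with witnesses $v\in\mathbb R^d$ and $q\in\mathbb Z_{+}^d$ (positive integers) if for almost every $x\in\Pi_\Lambda$,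 with $S=\Lambda_x$, for all $1\le l\le d$ and all $p\in\mathcal M^{l-1}$: the set $\mathcal Z^l_p$ has exactly $q_l$ elements, the numbers $v_lz$ with $z\in\mathcal Z^l_p$ are distinct modulo $q_l$, and their residues modulo $q_l$ are integers. $\Omega$ is perfectly admissible if it is so with some witnesses $(v,q)$. *Shift index sets.* For $S\subset\mathbb R^l$ define $\mathcal K^l(S)\subset\mathbb Z_{\ge0}^l$ recursively. $\mathcal K^1(S)=\{0,\dots,\#S-1\}$. For $l\ge2$ enumerate $\mathcal M^{l-1}(S)=\{m_1,\dots,m_N\}$ so that $c_i=\#\{z:(m_i,z)\in S\}$ is nondecreasing, put $c_0=0$, and let $\mathcal K^l(S)=\bigcup_{i=1}^N\mathcal K^{l-1}(\{m_i,\dots,m_N\})\times\{c_{i-1},\dots,c_i-1\}$ (this does not depend on how ties are broken). **Corollary.** (a) If $\Omega$ is perfectly admissible, then there are $a_1,\dots,a_k\in\mathbb R^d$, pairwise distinct modulo $\Lambda^*$, such that $\{e_l\}_{l\in L}$ with $L=\bigcup_{s=1}^k(\Lambda^*+a_s)$ is an orthogonal basis of $L^2(\Omega)$. (b) More precisely,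 let $\Omega$ be perfectly admissible with witnesses $(v,q)$, let $\delta$ be the diagonal matrix with $\delta_{ll}=v_l/q_l$, and let $\eta\in\Lambda^*$. Then there are $a_1,\dots,a_k$, pairwise distinct modulo $\Lambda^*$, with the following properties. For almost every $x\in\Pi_\Lambda$ one has $\{a_1,\dots,a_k\}=\{\delta j+\eta: j\in\mathcal K^d(\Lambda_x)\}$. More exactly, $a_s=\delta j_s+\eta$, where $j_1,\dots,j_k$ enumerates $\prod_{l=1}^d\{0,\dots,q_l-1\}$. The exponentials $\{e_l\}_{l\in L}$, $L=\bigcup_s(\Lambda^*+a_s)$, form an orthogonal basis of $L^2(\Omega)$. Moreover, for almost every $x\in\Pi_\Lambda$: 1. $\#\Lambda_x=k$. 2. For all $1\le l\le d$ and $p\in\mathcal M^{l-1}(\Lambda_x)$ the elements $z_0,\dots,z_{q_l-1}$ of $\mathcal Z^l_p$ can be ordered so that the Vandermonde matrix $\bigl((e^{-2\pi i\delta_{ll}z_t})^s\bigr)_{0\le s,t<q_l}$ equals the DFT matrix $F_{q_l}=(e^{-2\pi i st/q_l})_{0\le s,t<q_l}$. 3. For every enumeration $\lambda_1,\dots,\lambda_k$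 of $\Lambda_x$, the matrix $V$ with entries $V_{sr}=e^{-2\pi i\lambda_r\cdot a_s}$ satisfies $V^*V=kI$. If its rows are indexed by the tuples $j_s$ and its columns are suitably indexed by $\prod_{l}\{0,\dots,q_l-1\}$, then $V=F_{q_1}\otimes F_{q_2}\otimes\cdots\otimes F_{q_d}$. -/

import Mathlib

open MeasureTheory
open scoped ENNReal Matrix

noncomputable section

namespace MultiTile

/-! Points of `ℝ^d` are functions `Fin d → ℝ`; `volume` is Lebesgue measure and `⬝ᵥ` the usual
dot product.  (No norm on `ℝ^d` is used anywhere.) -/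

/-- The full lattice `Λ = M ℤ^d` (for `M` invertible). -/
def lattice {d : ℕ} (M : Matrix (Fin d) (Fin d) ℝ) : Set (Fin d → ℝ) :=
  {y | ∃ z : Fin d → ℤ, y = M *ᵥ (fun i => (z i : ℝ))}

/-- The dual lattice `Λ* = M⁻ᵀ ℤ^d`. -/
def dualLattice {d : ℕ} (M : Matrix (Fin d) (Fin d) ℝ) : Set (Fin d → ℝ) :=
  {y | ∃ z : Fin d → ℤ, y = (M⁻¹)ᵀ *ᵥ (fun i => (z i : ℝ))}

/-- The fundamental domain `Π_Λ = M [0,1)^d`. -/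
def fundDomain {d : ℕ} (M : Matrix (Fin d) (Fin d) ℝ) : Set (Fin d → ℝ) :=
  {y | ∃ t : Fin d → ℝ, (∀ i, t i ∈ Set.Ico (0 : ℝ) 1) ∧ y = M *ᵥ t}

/-- `Ω` is a `k`-tile for `Λ = M ℤ^d`: a Lebesgue measurable set of finite positive measure with
`∑_{l ∈ Λ} χ_Ω(x - l) = k` for almost all `x`. -/
structure IsKTile {d : ℕ} (M : Matrix (Fin d) (Fin d) ℝ) (k : ℕ) (Ω : Set (Fin d → ℝ)) :
    Prop where
  measurable : NullMeasurableSet Ω volume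
  pos : 0 < volume Ω
  finite : volume Ω < ∞
  tiles : ∀ᵐ x : Fin d → ℝ,
    ∑' l : lattice M, Ω.indicator (fun _ => (1 : ℝ≥0∞)) (x - (l : Fin d → ℝ)) = (k : ℝ≥0∞)

/-- `Λ_x = {λ ∈ Λ | x + λ ∈ Ω}`. -/
def latticeAt {d : ℕ} (M : Matrix (Fin d) (Fin d) ℝ) (Ω : Set (Fin d → ℝ)) (x : Fin d → ℝ) :
    Set (Fin d → ℝ) :=
  {y | y ∈ lattice M ∧ x + y ∈ Ω}

/-- The set `ℳ^l` of the initial segments of length `l` of the vectors in `S = ℳ^d`. -/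
def truncate {d : ℕ} (S : Set (Fin d → ℝ)) (l : ℕ) (hl : l ≤ d) : Set (Fin l → ℝ) :=
  (fun (m : Fin d → ℝ) (i : Fin l) => m (Fin.castLE hl i)) '' S

/-- The set `{z | (p, z) ∈ S}` of the last coordinates of the children of a node `p`. -/
def children {l : ℕ} (S : Set (Fin (l + 1) → ℝ)) (p : Fin l → ℝ) : Set ℝ :=
  {z | (Fin.snoc p z : Fin (l + 1) → ℝ) ∈ S}

/-- The sets `𝒵^{l+1}_p`, for a node `p` of `ℳ^l`, where `l = 0, …, d - 1`.  For `l = 0` there is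
only the empty node, and the set is `ℳ^1`. -/
def levelSet {d : ℕ} (S : Set (Fin d → ℝ)) (l : Fin d) (p : Fin (l : ℕ) → ℝ) : Set ℝ :=
  children (truncate S ((l : ℕ) + 1) l.isLt) p

/-- The representative in `[0, q)` of the real number `y` modulo `q`. -/
def realMod (y : ℝ) (q : ℕ) : ℝ := y - (q : ℝ) * (⌊y / (q : ℝ)⌋ : ℝ)

/-- Weak `(v,q)`-admissibility: for almost every `x ∈ Π_Λ`, on each `𝒵^l_p` the numbers `v_l z`
are distinct modulo `q_l`. -/
def IsWeaklyAdmissible {d : ℕ} (M : Matrix (Fin d) (Fin d) ℝ) (Ω : Set (Fin d → ℝ))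
    (v : Fin d → ℝ) (q : Fin d → ℕ) : Prop :=
  (∀ l, 0 < q l) ∧
  ∀ᵐ x ∂(volume.restrict (fundDomain M)), ∀ l : Fin d,
    ∀ p ∈ truncate (latticeAt M Ω x) (l : ℕ) l.isLt.le,
      ((fun z => realMod (v l * z) (q l)) '' levelSet (latticeAt M Ω x) l p).encard
        = (levelSet (latticeAt M Ω x) l p).encard

/-- Strong `(v,q)`-admissibility: moreover, the sets `{v_l z mod q_l | z ∈ 𝒵^l_p}` consist of
integers. -/
def IsStronglyAdmissible {d : ℕ} (M : Matrix (Fin d) (Fin d) ℝ) (Ω : Set (Fin d → ℝ))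
    (v : Fin d → ℝ) (q : Fin d → ℕ) : Prop :=
  IsWeaklyAdmissible M Ω v q ∧
  ∀ᵐ x ∂(volume.restrict (fundDomain M)), ∀ l : Fin d,
    ∀ p ∈ truncate (latticeAt M Ω x) (l : ℕ) l.isLt.le,
      (fun z => realMod (v l * z) (q l)) '' levelSet (latticeAt M Ω x) l p
        ⊆ Set.range (fun n : ℤ => (n : ℝ))

/-- Perfect admissibility with witnesses `v` and `q`: strong `(v,q)`-admissibility, where for
almost every `x ∈ Π_Λ` all the sets `𝒵^l_p` of level `l` have exactly `q_l` elements. -/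
def IsPerfectlyAdmissibleWith {d : ℕ} (M : Matrix (Fin d) (Fin d) ℝ) (Ω : Set (Fin d → ℝ))
    (v : Fin d → ℝ) (q : Fin d → ℕ) : Prop :=
  IsStronglyAdmissible M Ω v q ∧
  ∀ᵐ x ∂(volume.restrict (fundDomain M)), ∀ l : Fin d,
    ∀ p ∈ truncate (latticeAt M Ω x) (l : ℕ) l.isLt.le,
      (levelSet (latticeAt M Ω x) l p).encard = (q l : ℕ∞)

def IsPerfectlyAdmissible {d : ℕ} (M : Matrix (Fin d) (Fin d) ℝ) (Ω : Set (Fin d → ℝ)) : Prop :=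
  ∃ (v : Fin d → ℝ) (q : Fin d → ℕ), IsPerfectlyAdmissibleWith M Ω v q

/-- The shift index set `𝒦^l(S)` of a set `S` of vectors in `ℝ^l`, by recursion on `l`:
`(j', n) ∈ 𝒦^{l+1}(S)` iff `j' ∈ 𝒦^l(S')`, where `S'` is the set of those initial segments
(of length `l`) of vectors in `S` that have more than `n` children.  See `shiftIndexSet_one` and
`shiftIndexSet_succ_eq_iUnion` for the form of the recursion that enumerates the nodes by
increasing number of children; the result does not depend on how ties are broken. -/
def shiftIndexSet : (l : ℕ) → Set (Fin l → ℝ) → Set (Fin l → ℕ)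
  | 0, S => {_j | S.Nonempty}
  | l + 1, S => {j | (fun i : Fin l => j i.castSucc) ∈ shiftIndexSet l
      {m | m ∈ truncate S l (Nat.le_succ l) ∧ (j (Fin.last l) : ℕ∞) < (children S m).encard}}

/-- `𝒦^1(S) = {0, …, #S - 1}`. -/
theorem shiftIndexSet_one (S : Set (Fin 1 → ℝ)) :
    shiftIndexSet 1 S = {j | (j 0 : ℕ∞) < S.encard} := by
  have hch : ∀ m : Fin 0 → ℝ, (children S m).encard = S.encard := by
    intro m
    have h : children S m = (fun y : Fin 1 → ℝ => y 0) '' S := by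
      ext z
      constructor
      · intro hz
        exact ⟨_, hz, by simp [Fin.snoc]⟩
      · rintro ⟨y, hy, rfl⟩
        have h2 : (Fin.snoc m (y 0) : Fin 1 → ℝ) = y := by
          funext i
          fin_cases i
          simp [Fin.snoc]
        simpa [children, h2] using hy
    rw [h]
    refine Set.InjOn.encard_image ?_
    intro y _ y' _ hyy
    funext i
    fin_cases i
    exact hyy
  ext j
  simp only [shiftIndexSet, Set.mem_ofPred_eq, hch]
  constructor
  · rintro ⟨m, -, hm⟩
    exact hm
  · intro hj
    have hS : S.Nonempty := by
      rw [← Set.encard_pos]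
      exact lt_of_le_of_lt (by simp) hj
    obtain ⟨y, hy⟩ := hS
    exact ⟨_, ⟨y, hy, rfl⟩, hj⟩

/-- If `m_0, …, m_{N-1}` enumerate the initial segments of `S` so that the numbers `c_i` of
children are nondecreasing, then `𝒦^{l+1}(S)` is the union over `i` of the products
`𝒦^l({m_i, m_{i+1}, …}) × {c_{i-1}, …, c_i - 1}`, with `c_{i-1}` read as `0` for `i = 0`. -/
theorem shiftIndexSet_succ_eq_iUnion {l N : ℕ} (S : Set (Fin (l + 1) → ℝ))
    (m : Fin N → (Fin l → ℝ))
    (hrange : Set.range m = truncate S l (Nat.le_succ l))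
    (hmono : Monotone (fun i => (children S (m i)).encard)) :
    shiftIndexSet (l + 1) S = ⋃ i : Fin N,
      {j | (fun a : Fin l => j a.castSucc) ∈ shiftIndexSet l (m '' Set.Ici i) ∧
        (∀ i' : Fin N, (i' : ℕ) + 1 = (i : ℕ) →
          (children S (m i')).encard ≤ (j (Fin.last l) : ℕ∞)) ∧
        (j (Fin.last l) : ℕ∞) < (children S (m i)).encard} := by
  have hempty : ∀ (l : ℕ), shiftIndexSet l ∅ = ∅ := by
    intro l
    induction l with
    | zero => ext j; simp [shiftIndexSet]
    | succ l ih =>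
      ext j
      simp [shiftIndexSet, truncate, ih]
  have key : ∀ (n : ℕ∞) (i : Fin N),
      (∀ i' : Fin N, (i' : ℕ) + 1 = (i : ℕ) → (children S (m i')).encard ≤ n) →
      n < (children S (m i)).encard →
      {y | y ∈ truncate S l (Nat.le_succ l) ∧ n < (children S y).encard} = m '' Set.Ici i := by
    intro n i h1 h2
    ext y
    simp only [Set.mem_ofPred_eq, ← hrange, Set.mem_range, Set.mem_image, Set.mem_Ici]
    constructor
    · rintro ⟨⟨b, rfl⟩, hb⟩
      refine ⟨b, ?_, rfl⟩
      by_contra hlt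
      have hlt' : (b : ℕ) < (i : ℕ) := by
        have := not_le.mp hlt
        exact this
      have hi' : (i : ℕ) - 1 < N := by have := i.isLt; omega
      have h3 := h1 ⟨(i : ℕ) - 1, hi'⟩ (by simp only; omega)
      have h4 : (children S (m b)).encard ≤ (children S (m ⟨(i : ℕ) - 1, hi'⟩)).encard := by
        apply hmono
        rw [Fin.le_def]
        simp only
        omega
      exact absurd hb (not_lt.mpr (h4.trans h3))
    · rintro ⟨b, hb, rfl⟩
      exact ⟨⟨b, rfl⟩, lt_of_lt_of_le h2 (hmono hb)⟩
  ext j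
  simp only [Set.mem_iUnion, Set.mem_ofPred_eq]
  constructor
  · intro hj
    simp only [shiftIndexSet, Set.mem_ofPred_eq] at hj
    have hex : ∃ n : ℕ, ∃ h : n < N,
        (j (Fin.last l) : ℕ∞) < (children S (m ⟨n, h⟩)).encard := by
      by_contra hno
      push Not at hno
      have : {y | y ∈ truncate S l (Nat.le_succ l) ∧
          (j (Fin.last l) : ℕ∞) < (children S y).encard} = ∅ := by
        ext y
        simp only [← hrange, Set.mem_ofPred_eq, Set.mem_range, Set.mem_empty_iff_false, iff_false]
        rintro ⟨⟨b, rfl⟩, hb⟩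
        exact absurd hb (not_lt.mpr (hno b b.isLt))
      rw [this, hempty] at hj
      exact hj
    classical
    obtain ⟨hN, hlt⟩ := Nat.find_spec hex
    have hmin : ∀ i' : Fin N, (i' : ℕ) + 1 = Nat.find hex →
        (children S (m i')).encard ≤ (j (Fin.last l) : ℕ∞) := by
      intro i' hi'
      have := Nat.find_min hex (m := (i' : ℕ)) (by omega)
      push Not at this
      exact this i'.isLt
    refine ⟨⟨Nat.find hex, hN⟩, ?_, hmin, hlt⟩
    rw [← key _ ⟨Nat.find hex, hN⟩ hmin hlt]
    exact hj
  · rintro ⟨i, hj, h1, h2⟩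
    simp only [shiftIndexSet, Set.mem_ofPred_eq]
    rw [key _ i h1 h2]
    exact hj

/-- The set of lattice shifts `{δ j + η | j ∈ 𝒦^d(S)}`, where `δ` is the diagonal matrix with
entries `v_l / q_l`. -/
def shiftSet {d : ℕ} (v : Fin d → ℝ) (q : Fin d → ℕ) (η : Fin d → ℝ) (S : Set (Fin d → ℝ)) :
    Set (Fin d → ℝ) :=
  {a | ∃ j ∈ shiftIndexSet d S,
    a = Matrix.diagonal (fun l => v l / (q l : ℝ)) *ᵥ (fun l => (j l : ℝ)) + η}

/-- `e_l(x) = exp(2πi l·x)`. -/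
def expFun {d : ℕ} (l x : Fin d → ℝ) : ℂ :=
  Complex.exp (2 * (Real.pi : ℂ) * Complex.I * ((l ⬝ᵥ x : ℝ) : ℂ))

/-- `L = ⋃_s (Λ* + a_s)`. -/
def frequencies {d k : ℕ} (M : Matrix (Fin d) (Fin d) ℝ) (a : Fin k → Fin d → ℝ) :
    Set (Fin d → ℝ) :=
  ⋃ s : Fin k, (fun y => y + a s) '' dualLattice M

/-- `{e_l}_{l ∈ L}` is an orthogonal basis of `L²(Ω)`.  As every `e_l` has norm `|Ω|^{1/2}`, this
says that the `e_l`, divided by `|Ω|^{1/2}`, form a Hilbert (complete orthonormal) basis. -/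
def IsOrthogonalBasisOfExponentials {d : ℕ} (Ω L : Set (Fin d → ℝ)) : Prop :=
  ∃ B : HilbertBasis L ℂ (Lp ℂ 2 (volume.restrict Ω)),
    ∀ l : L, expFun (l : Fin d → ℝ) =ᵐ[volume.restrict Ω]
      fun x => ((Real.sqrt (volume.real Ω) : ℝ) : ℂ) * (B l) x

/-- The matrix `V` with entries `V_{sr} = exp(-2πi λ_r·a_s)`. -/
def V {d k : ℕ} (a lam : Fin k → Fin d → ℝ) : Matrix (Fin k) (Fin k) ℂ :=
  Matrix.of fun s r =>
    Complex.exp (-(2 * (Real.pi : ℂ) * Complex.I * ((lam r ⬝ᵥ a s : ℝ) : ℂ)))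

/-- The square Vandermonde matrix `W_{st} = w_t^s`, `0 ≤ s, t < n`, with nodes
`w_t = exp(-2πi δ z_t)`. -/
def W {n : ℕ} (δ : ℝ) (z : Fin n → ℝ) : Matrix (Fin n) (Fin n) ℂ :=
  (Matrix.vandermonde fun t =>
    Complex.exp (-(2 * (Real.pi : ℂ) * Complex.I * ((δ * z t : ℝ) : ℂ))))ᵀ

/-- The `n × n` discrete Fourier matrix: the Vandermonde matrix whose nodes are the `n`-th roots of
unity `exp(-2πi t / n)`. -/
def dft (n : ℕ) : Matrix (Fin n) (Fin n) ℂ :=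
  W (1 / (n : ℝ)) (fun t => ((t : ℕ) : ℝ))

/-- The Kronecker product `A_1 ⊗ ⋯ ⊗ A_d` of square matrices, rows and columns being indexed by
tuples. -/
def kroneckerProd {d : ℕ} {q : Fin d → ℕ}
    (A : (l : Fin d) → Matrix (Fin (q l)) (Fin (q l)) ℂ) :
    Matrix ((l : Fin d) → Fin (q l)) ((l : Fin d) → Fin (q l)) ℂ :=
  Matrix.of fun s t => ∏ l, A l (s l) (t l)

end MultiTile

end

/-! The problem is fibred over the fundamental domain. For `f` on `Ω` write `f_x = (f(x + λ_r))_r`,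
where `λ_r` enumerates `Λ_x`. Unfolding an integral over `Ω` along the lattice gives `∫_Ω f e_{-(y +
a_s)} = ∫_Π e_{-(y + a_s)}(x) (V f_x)_s dx` for `y ∈ Λ*`, because `e_y` is `Λ`-periodic. Hence `V*V
= kI` for almost every `x` suffices: its row form `VV* = kI` yields orthogonality, while uniqueness
of Fourier series and injectivity of `V` yield completeness
(`IsKTile.isOrthogonalBasisOfExponentials`).

The matrix identity comes from the tree. Each node of level `l` has `q_l` children with distinct
integer residues of `v_l z` modulo `q_l`, so every residue occurs exactly once. Reading off residues
coordinate by coordinate therefore identifies `Λ_x` with the box `∏ {0, …, q_l - 1}`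
(`IsPerfectTree.exists_parametrization`). If `λ` has digits `t` and `a = δ j + η`, then `λ·a` equals
`∑ t_l j_l / q_l` modulo integers, since `η·λ` is an integer. So `V` is, up to relabelling, the
Kronecker product of the matrices `F_{q_l}` (`IsPerfectTree.exists_reindex_V`), and `V*V = (∏ q_l) I
= kI`.

The shifts are independent of `x` because equal numbers of children on each level force the shift
index set to be the whole box (`shiftIndexSet_eq_box`). -/

noncomputable section

namespace MultiTile

/-! ### Fourier uniqueness on the torus for a general measure -/

section

open Filter Topology
open scoped Pointwise

/-- An integrable function on the torus whose Fourier coefficients with respect to a measure `ν`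
all vanish is zero `ν`-almost everywhere. -/
theorem ae_eq_zero_of_integral_mul_mFourier_eq_zero {ι : Type*} [Fintype ι]
    (ν : Measure (UnitAddTorus ι)) {g : UnitAddTorus ι → ℂ} (hg : Integrable g ν)
    (h : ∀ n : ι → ℤ, ∫ θ, g θ * UnitAddTorus.mFourier n θ ∂ν = 0) : g =ᵐ[ν] 0 := by
  have hint : ∀ φ : C(UnitAddTorus ι, ℂ), Integrable (fun θ => g θ * φ θ) ν := fun φ =>
    hg.mul_bdd (c := ‖φ‖) φ.continuous.aestronglyMeasurable
      (Eventually.of_forall fun θ => φ.norm_coe_le_norm θ)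
  have hcont : ∀ φ : C(UnitAddTorus ι, ℂ), ∫ θ, g θ * φ θ ∂ν = 0 := by
    let T : C(UnitAddTorus ι, ℂ) →ₗ[ℂ] ℂ :=
      { toFun := fun φ => ∫ θ, g θ * φ θ ∂ν
        map_add' := fun φ ψ => by
          simp only [ContinuousMap.add_apply, mul_add]
          exact integral_add (hint φ) (hint ψ)
        map_smul' := fun c φ => by
          simp only [ContinuousMap.smul_apply, smul_eq_mul, RingHom.id_apply]
          rw [← integral_const_mul]
          congr 1
          ext θ
          ring }
    have hT : ∀ φ, ‖T φ‖ ≤ (∫ θ, ‖g θ‖ ∂ν) * ‖φ‖ := fun φ => by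
      refine (norm_integral_le_integral_norm _).trans ?_
      rw [← integral_mul_const]
      refine integral_mono (hint φ).norm (hg.norm.mul_const _) fun θ => ?_
      simp only [norm_mul]
      gcongr
      exact φ.norm_coe_le_norm θ
    let T' := T.mkContinuous _ hT
    -- Integration against `g` is bounded for the sup norm, so its kernel is closed; it contains the
    -- trigonometric polynomials, which are dense in the continuous functions.
    have hker : (Submodule.span ℂ (Set.range (UnitAddTorus.mFourier (d := ι)))).topologicalClosure
        ≤ T'.ker := by
      refine Submodule.topologicalClosure_minimal _ ?_ T'.isClosed_ker
      rw [Submodule.span_le]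
      rintro _ ⟨n, rfl⟩
      exact h n
    rw [UnitAddTorus.span_mFourier_closure_eq_top] at hker
    exact fun φ => hker (Submodule.mem_top (x := φ))
  refine ae_eq_zero_of_forall_setIntegral_isClosed_eq_zero hg fun s hs => ?_
  rw [← integral_indicator hs.measurableSet]
  -- Continuous functions with values in `[0, 1]` converging pointwise to the indicator of the
  -- closed set `s`, so that dominated convergence passes from continuous functions to closed sets.
  let ψ : ℕ → C(UnitAddTorus ι, ℂ) := fun n =>
    ⟨fun θ => (((hs.apprSeq n θ : NNReal) : ℝ) : ℂ), by fun_prop⟩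
  have hlim : Tendsto (fun n => ∫ θ, g θ * ψ n θ ∂ν) atTop (𝓝 (∫ θ, s.indicator g θ ∂ν)) := by
    refine tendsto_integral_of_dominated_convergence (fun θ => ‖g θ‖)
      (fun n => (hint _).aestronglyMeasurable) hg.norm (fun n => Eventually.of_forall fun θ => ?_)
      (Eventually.of_forall fun θ => ?_)
    · have : ‖ψ n θ‖ ≤ 1 := by
        simp only [ψ, ContinuousMap.coe_mk, Complex.norm_real, NNReal.norm_eq]
        exact_mod_cast HasOuterApproxClosed.apprSeq_apply_le_one hs n θ
      rw [norm_mul]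
      exact mul_le_of_le_one_right (norm_nonneg _) this
    · have h1 := (tendsto_pi_nhds.mp (HasOuterApproxClosed.tendsto_apprSeq hs)) θ
      have h2 : Tendsto (fun n => ψ n θ) atTop
          (𝓝 (((s.indicator (fun _ => (1 : NNReal)) θ : NNReal) : ℝ) : ℂ)) :=
        (Complex.continuous_ofReal.tendsto _).comp ((NNReal.continuous_coe.tendsto _).comp h1)
      have h3 := h2.const_mul (g θ)
      convert h3 using 2
      by_cases hθ : θ ∈ s <;> simp [hθ]
  refine tendsto_nhds_unique hlim ?_
  simp [hcont]

/-! ### The lattice and its fundamental domain -/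

variable {d : ℕ}

/-- The lattice `Λ = M ℤ^d` as an additive subgroup. -/
def latticeSubgroup (M : Matrix (Fin d) (Fin d) ℝ) : AddSubgroup (Fin d → ℝ) where
  carrier := lattice M
  zero_mem' := ⟨0, by simp [← Pi.zero_def]⟩
  add_mem' := by
    rintro _ _ ⟨z, rfl⟩ ⟨w, rfl⟩
    refine ⟨z + w, ?_⟩
    rw [← Matrix.mulVec_add]
    congr 1
    ext i
    simp
  neg_mem' := by
    rintro _ ⟨z, rfl⟩
    refine ⟨-z, ?_⟩
    rw [← Matrix.mulVec_neg]
    congr 1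
    ext i
    simp

instance (M : Matrix (Fin d) (Fin d) ℝ) : Countable (latticeSubgroup M) := by
  have : (latticeSubgroup M : Set (Fin d → ℝ)) =
      Set.range fun z : Fin d → ℤ => M *ᵥ (fun i => (z i : ℝ)) := by
    ext y
    exact ⟨fun ⟨z, hz⟩ => ⟨z, hz.symm⟩, fun ⟨z, hz⟩ => ⟨z, hz.symm⟩⟩
  exact (this ▸ Set.countable_range _ : (latticeSubgroup M : Set (Fin d → ℝ)).Countable).to_subtype

variable {M : Matrix (Fin d) (Fin d) ℝ}

theorem mulVec_inv_mulVec (hM : M.det ≠ 0) (x : Fin d → ℝ) : M *ᵥ (M⁻¹ *ᵥ x) = x := by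
  rw [Matrix.mulVec_mulVec, Matrix.mul_nonsing_inv _ (isUnit_iff_ne_zero.mpr hM),
    Matrix.one_mulVec]

theorem inv_mulVec_mulVec (hM : M.det ≠ 0) (x : Fin d → ℝ) : M⁻¹ *ᵥ (M *ᵥ x) = x := by
  rw [Matrix.mulVec_mulVec, Matrix.nonsing_inv_mul _ (isUnit_iff_ne_zero.mpr hM),
    Matrix.one_mulVec]

theorem mem_fundDomain_iff (hM : M.det ≠ 0) {x : Fin d → ℝ} :
    x ∈ fundDomain M ↔ ∀ i, (M⁻¹ *ᵥ x) i ∈ Set.Ico (0 : ℝ) 1 := by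
  constructor
  · rintro ⟨t, ht, rfl⟩
    rwa [inv_mulVec_mulVec hM]
  · exact fun h => ⟨_, h, (mulVec_inv_mulVec hM x).symm⟩

theorem continuous_mulVec_left (A : Matrix (Fin d) (Fin d) ℝ) :
    Continuous fun x : Fin d → ℝ => A *ᵥ x :=
  continuous_const.matrix_mulVec continuous_id

theorem measurableSet_fundDomain (hM : M.det ≠ 0) : MeasurableSet (fundDomain M) := by
  have : fundDomain M = (fun x => M⁻¹ *ᵥ x) ⁻¹' Set.univ.pi fun _ => Set.Ico (0 : ℝ) 1 := by
    ext x
    simp only [mem_fundDomain_iff hM, Set.mem_preimage, Set.mem_univ_pi]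
  rw [this]
  exact (continuous_mulVec_left M⁻¹).measurable
    (MeasurableSet.univ_pi fun _ => measurableSet_Ico)

theorem volume_fundDomain_lt_top (M : Matrix (Fin d) (Fin d) ℝ) : volume (fundDomain M) < ∞ := by
  have hc : IsCompact ((fun x => M *ᵥ x) '' Set.univ.pi fun _ : Fin d => Set.Icc (0 : ℝ) 1) :=
    (isCompact_univ_pi fun _ => isCompact_Icc).image (continuous_mulVec_left M)
  refine (measure_mono ?_).trans_lt hc.measure_lt_top
  rintro _ ⟨t, ht, rfl⟩
  exact ⟨t, fun i _ => ⟨(ht i).1, (ht i).2.le⟩, rfl⟩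

instance (M : Matrix (Fin d) (Fin d) ℝ) : IsFiniteMeasure (volume.restrict (fundDomain M)) :=
  ⟨by simpa using volume_fundDomain_lt_top M⟩

theorem isAddFundamentalDomain_fundDomain (hM : M.det ≠ 0) :
    IsAddFundamentalDomain (latticeSubgroup M) (fundDomain M) volume := by
  refine IsAddFundamentalDomain.mk' (measurableSet_fundDomain hM).nullMeasurableSet fun x => ?_
  refine ⟨⟨M *ᵥ fun i => ((-⌊(M⁻¹ *ᵥ x) i⌋ : ℤ) : ℝ), _, rfl⟩, ?_, ?_⟩
  · simp only [AddSubgroup.mk_vadd, vadd_eq_add, mem_fundDomain_iff hM, Matrix.mulVec_add,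
      inv_mulVec_mulVec hM, Pi.add_apply, Int.cast_neg]
    intro i
    rw [neg_add_eq_sub]
    exact ⟨Int.fract_nonneg _, Int.fract_lt_one _⟩
  · rintro ⟨_, z, rfl⟩ hz
    change (M *ᵥ _) + x ∈ fundDomain M at hz
    simp only [mem_fundDomain_iff hM, Matrix.mulVec_add, inv_mulVec_mulVec hM,
      Pi.add_apply] at hz
    congr 2
    funext i
    have h1 := hz i
    have : ⌊(M⁻¹ *ᵥ x) i⌋ = -z i := by
      rw [Int.floor_eq_iff]
      push_cast
      constructor <;> linarith [h1.1, h1.2]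
    rw [this, neg_neg]

theorem volume_fundDomain_ne_zero (hM : M.det ≠ 0) : volume (fundDomain M) ≠ 0 :=
  (isAddFundamentalDomain_fundDomain hM).measure_ne_zero (NeZero.ne _)

/-- A property that holds for almost all points of the fundamental domain holds somewhere. -/
theorem exists_of_ae_fundDomain (hM : M.det ≠ 0) {P : (Fin d → ℝ) → Prop}
    (h : ∀ᵐ x ∂(volume.restrict (fundDomain M)), P x) : ∃ x, P x := by
  have : NeZero (volume.restrict (fundDomain M)) :=
    ⟨by simpa using volume_fundDomain_ne_zero hM⟩
  exact h.exists

/-- Periodization over the lattice: integrability and the unfolding of the integral. -/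
theorem integrable_tsum_lattice (hM : M.det ≠ 0) {F : (Fin d → ℝ) → ℂ} (hF : Integrable F) :
    Integrable (fun x => ∑' g : latticeSubgroup M, F (x + g))
      (volume.restrict (fundDomain M)) ∧
    ∫ x in fundDomain M, ∑' g : latticeSubgroup M, F (x + g) = ∫ x, F x := by
  have hfd := isAddFundamentalDomain_fundDomain hM
  have hmeas : ∀ g : latticeSubgroup M,
      AEStronglyMeasurable (fun x => F (x + g)) (volume.restrict (fundDomain M)) := fun g =>
    ((measurePreserving_add_right volume (g : Fin d → ℝ)).integrable_comp_of_integrable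
      hF).aestronglyMeasurable.restrict
  -- The translates of the domain tile the space, so the `L¹` norms of the pieces add up to that of
  -- `F`. This gives almost everywhere absolute convergence, the integrable bound and the
  -- interchange of sum and integral.
  have hsum : ∑' g : latticeSubgroup M, ∫⁻ x in fundDomain M, ‖F (x + g)‖ₑ = ∫⁻ x, ‖F x‖ₑ := by
    rw [hfd.lintegral_eq_tsum'']
    simp only [AddSubgroup.vadd_def, vadd_eq_add, add_comm]
  have hfin : ∫⁻ x in fundDomain M, ∑' g : latticeSubgroup M, ‖F (x + g)‖ₑ < ∞ := by
    rw [lintegral_tsum fun g => (hmeas g).enorm, hsum]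
    exact hF.2
  have hsummable : ∀ᵐ x ∂(volume.restrict (fundDomain M)),
      Summable fun g : latticeSubgroup M => F (x + g) := by
    filter_upwards [ae_lt_top' (AEMeasurable.tsum fun g => (hmeas g).enorm) hfin.ne]
      with x hx
    exact Summable.of_norm (by
      have := ENNReal.tsum_coe_ne_top_iff_summable.1 hx.ne
      exact NNReal.summable_coe.2 this)
  refine ⟨⟨?_, ?_⟩, ?_⟩
  · refine aestronglyMeasurable_of_tendsto_ae (u := (atTop : Filter (Finset (latticeSubgroup M))))
      (f := fun s x => ∑ g ∈ s, F (x + g))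
      (fun s => Finset.aestronglyMeasurable_fun_sum s fun g _ => hmeas g) ?_
    filter_upwards [hsummable] with x hx using hx.hasSum
  · refine lt_of_le_of_lt (lintegral_mono fun x => ?_) hfin
    exact enorm_tsum_le_tsum_enorm
  · rw [integral_tsum hmeas (hsum ▸ hF.2.ne), hfd.integral_eq_tsum'' F hF]
    simp only [AddSubgroup.vadd_def, vadd_eq_add, add_comm]

/-- The exceptional set splits into countably many pieces, each a lattice translate of a null subset
of the fundamental domain. -/
theorem ae_of_ae_fundDomain_forall_lattice (hM : M.det ≠ 0) {P : (Fin d → ℝ) → Prop}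
    (h : ∀ᵐ x ∂(volume.restrict (fundDomain M)), ∀ g ∈ lattice M, P (x + g)) :
    ∀ᵐ x : Fin d → ℝ, P x := by
  rw [ae_iff, (isAddFundamentalDomain_fundDomain hM).measure_eq_tsum, ENNReal.tsum_eq_zero]
  intro g
  rw [ae_restrict_iff' (measurableSet_fundDomain hM)] at h
  refine measure_mono_null ?_ h
  rintro x ⟨⟨y, hy, rfl⟩, hx⟩ hP
  refine hy ?_
  have := hP hx _ (neg_mem g.2 : -(g : Fin d → ℝ) ∈ latticeSubgroup M)
  simpa [AddSubgroup.vadd_def] using this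

/-! ### Exponentials -/

theorem expFun_add_left (l l' x : Fin d → ℝ) : expFun (l + l') x = expFun l x * expFun l' x := by
  rw [expFun, expFun, expFun, ← Complex.exp_add, add_dotProduct]
  push_cast
  ring_nf

theorem expFun_add_right (l x y : Fin d → ℝ) : expFun l (x + y) = expFun l x * expFun l y := by
  rw [expFun, expFun, expFun, ← Complex.exp_add, dotProduct_add]
  push_cast
  ring_nf

theorem conj_expFun (l x : Fin d → ℝ) : (starRingEnd ℂ) (expFun l x) = expFun (-l) x := by
  rw [expFun, expFun, ← Complex.exp_conj, neg_dotProduct]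
  simp [map_ofNat]

theorem norm_expFun (l x : Fin d → ℝ) : ‖expFun l x‖ = 1 := by
  rw [expFun, show 2 * (Real.pi : ℂ) * Complex.I * ((l ⬝ᵥ x : ℝ) : ℂ) =
    ((2 * Real.pi * (l ⬝ᵥ x) : ℝ) : ℂ) * Complex.I by push_cast; ring,
    Complex.norm_exp_ofReal_mul_I]

theorem expFun_zero_left (x : Fin d → ℝ) : expFun 0 x = 1 := by simp [expFun]

theorem continuous_expFun (l : Fin d → ℝ) : Continuous (expFun l) := by
  unfold expFun
  fun_prop

theorem dualLattice_dotProduct (M : Matrix (Fin d) (Fin d) ℝ) (n : Fin d → ℤ) (x : Fin d → ℝ) :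
    ((M⁻¹)ᵀ *ᵥ (fun i => (n i : ℝ))) ⬝ᵥ x = ∑ i, (n i : ℝ) * (M⁻¹ *ᵥ x) i := by
  rw [Matrix.mulVec_transpose, ← Matrix.dotProduct_mulVec]
  rfl

/-- The pairing of the dual lattice with the lattice is integral. -/
theorem exists_int_dotProduct (hM : M.det ≠ 0) {y g : Fin d → ℝ} (hy : y ∈ dualLattice M)
    (hg : g ∈ lattice M) : ∃ n : ℤ, y ⬝ᵥ g = n := by
  obtain ⟨n, rfl⟩ := hy
  obtain ⟨z, rfl⟩ := hg
  refine ⟨∑ i, n i * z i, ?_⟩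
  rw [dualLattice_dotProduct, inv_mulVec_mulVec hM]
  push_cast
  rfl

theorem expFun_eq_one_of_mem (hM : M.det ≠ 0) {y g : Fin d → ℝ} (hy : y ∈ dualLattice M)
    (hg : g ∈ lattice M) : expFun y g = 1 := by
  obtain ⟨n, hn⟩ := exists_int_dotProduct hM hy hg
  rw [expFun, hn, Complex.exp_eq_one_iff]
  exact ⟨n, by push_cast; ring⟩

theorem expFun_add_lattice (hM : M.det ≠ 0) {y g : Fin d → ℝ} (hy : y ∈ dualLattice M)
    (hg : g ∈ lattice M) (x : Fin d → ℝ) : expFun y (x + g) = expFun y x := by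
  rw [expFun_add_right, expFun_eq_one_of_mem hM hy hg, mul_one]

/-- Nontrivial characters integrate to zero over the fundamental domain. -/
theorem integral_expFun_fundDomain (hM : M.det ≠ 0) {y : Fin d → ℝ} (hy : y ∈ dualLattice M)
    (hy0 : y ≠ 0) : ∫ x in fundDomain M, expFun y x = 0 := by
  have hyy : y ⬝ᵥ y ≠ 0 := by simpa using hy0
  -- Chosen so that `y·h = 1/2`: translating the domain by `h` multiplies the integral by `-1`, but
  -- by periodicity the integral is the same over every fundamental domain.
  let h : Fin d → ℝ := (1 / (2 * (y ⬝ᵥ y))) • y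
  have hh : expFun y h = -1 := by
    have : y ⬝ᵥ h = 1 / 2 := by
      simp only [h, dotProduct_smul, smul_eq_mul]
      field_simp
    rw [expFun, this, ← Complex.exp_pi_mul_I]
    congr 1
    push_cast
    ring
  have hfd := isAddFundamentalDomain_fundDomain hM
  have hfd' := hfd.vadd_of_comm h
  have hper : ∀ (g : latticeSubgroup M) (x : Fin d → ℝ), expFun y (g +ᵥ x) = expFun y x := by
    intro g x
    rw [AddSubgroup.vadd_def, vadd_eq_add, add_comm, expFun_add_lattice hM hy g.2]
  have h1 := hfd.setIntegral_eq hfd' hper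
  have h2 : ∫ x in h +ᵥ fundDomain M, expFun y x = ∫ x in fundDomain M, expFun y (h + x) := by
    exact (measurePreserving_add_left volume h).setIntegral_image_emb
      (measurableEmbedding_addLeft h) _ _
  simp only [expFun_add_right, integral_const_mul, hh] at h2
  rw [← h1] at h2
  linear_combination h2 / 2

/-! ### Transfer to the torus and uniqueness of Fourier series on the fundamental domain -/

/-- The projection `ℝ^d → ℝ^d / Λ ≃ (ℝ / ℤ)^d`. -/
def toTorus (M : Matrix (Fin d) (Fin d) ℝ) (x : Fin d → ℝ) : UnitAddTorus (Fin d) :=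
  fun i => ((M⁻¹ *ᵥ x) i : UnitAddCircle)

/-- The section of the projection `ℝ^d → (ℝ / ℤ)^d` with values in the fundamental domain. -/
def ofTorus (M : Matrix (Fin d) (Fin d) ℝ) (θ : UnitAddTorus (Fin d)) : Fin d → ℝ :=
  M *ᵥ fun i => ((AddCircle.measurableEquivIco (1 : ℝ) 0 (θ i) : Set.Ico (0 : ℝ) (0 + 1)) : ℝ)

theorem measurable_toTorus (M : Matrix (Fin d) (Fin d) ℝ) : Measurable (toTorus M) :=
  measurable_pi_lambda _ fun i => AddCircle.measurable_mk'.comp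
    ((measurable_pi_apply i).comp (continuous_mulVec_left M⁻¹).measurable)

theorem measurable_ofTorus (M : Matrix (Fin d) (Fin d) ℝ) : Measurable (ofTorus M) :=
  (continuous_mulVec_left M).measurable.comp (measurable_pi_lambda _ fun i =>
    measurable_subtype_coe.comp ((AddCircle.measurableEquivIco (1 : ℝ) 0).measurable.comp
      (measurable_pi_apply i)))

theorem ofTorus_toTorus (hM : M.det ≠ 0) {x : Fin d → ℝ} (hx : x ∈ fundDomain M) :
    ofTorus M (toTorus M x) = x := by
  rw [mem_fundDomain_iff hM] at hx
  have : (fun i => ((AddCircle.measurableEquivIco (1 : ℝ) 0 (toTorus M x i) :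
      Set.Ico (0 : ℝ) (0 + 1)) : ℝ)) = M⁻¹ *ᵥ x := by
    funext i
    exact AddCircle.equivIco_coe_of_mem (p := (1 : ℝ)) (a := 0) (by simpa using hx i)
  rw [ofTorus, this, mulVec_inv_mulVec hM]

theorem mFourier_toTorus (M : Matrix (Fin d) (Fin d) ℝ) (n : Fin d → ℤ) (x : Fin d → ℝ) :
    UnitAddTorus.mFourier n (toTorus M x) = expFun ((M⁻¹)ᵀ *ᵥ (fun i => (n i : ℝ))) x := by
  rw [expFun, dualLattice_dotProduct]
  simp only [UnitAddTorus.mFourier, ContinuousMap.coe_mk, toTorus, fourier_coe_apply,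
    ← Complex.exp_sum]
  congr 1
  push_cast
  rw [Finset.mul_sum]
  refine Finset.sum_congr rfl fun i _ => ?_
  ring

/-- Uniqueness of Fourier series on the fundamental domain. -/
theorem ae_eq_zero_of_integral_mul_expFun_eq_zero (hM : M.det ≠ 0) {G : (Fin d → ℝ) → ℂ}
    (hG : Integrable G (volume.restrict (fundDomain M)))
    (h : ∀ y ∈ dualLattice M, ∫ x in fundDomain M, G x * expFun y x = 0) :
    ∀ᵐ x ∂(volume.restrict (fundDomain M)), G x = 0 := by
  set μ := volume.restrict (fundDomain M) with hμ
  -- This pushforward need not be identified with a multiple of Haar measure, as the uniqueness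
  -- result on the torus allows any measure. It is enough that `ofTorus` carries `ν` back to `μ`.
  set ν := μ.map (toTorus M) with hν
  have hid : ∀ᵐ x ∂μ, ofTorus M (toTorus M x) = x := by
    filter_upwards [ae_restrict_mem (measurableSet_fundDomain hM)] with x hx
    exact ofTorus_toTorus hM hx
  have hmap : ν.map (ofTorus M) = μ := by
    rw [hν, Measure.map_map (measurable_ofTorus M) (measurable_toTorus M)]
    conv_rhs => rw [← Measure.map_id (μ := μ)]
    exact Measure.map_congr hid
  have hGc : Integrable (G ∘ ofTorus M) ν :=
    (MeasurePreserving.mk (measurable_ofTorus M) hmap).integrable_comp_of_integrable hG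
  have hzero := ae_eq_zero_of_integral_mul_mFourier_eq_zero ν hGc fun n => by
    rw [hν, integral_map (measurable_toTorus M).aemeasurable]
    · rw [← h _ ⟨n, rfl⟩]
      refine integral_congr_ae ?_
      filter_upwards [hid] with x hx
      rw [Function.comp_apply, hx, mFourier_toTorus]
    · exact hGc.aestronglyMeasurable.mul
        (UnitAddTorus.mFourier n).continuous.aestronglyMeasurable
  filter_upwards [ae_of_ae_map (measurable_toTorus M).aemeasurable hzero, hid] with x hx hx'
  simpa [hx'] using hx

end

/-! ### From the matrix identity to an orthogonal basis -/

section

open Filter Topology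

variable {d k : ℕ} {M : Matrix (Fin d) (Fin d) ℝ} {Ω : Set (Fin d → ℝ)}

/-- The tiling sum counts the `l ∈ Λ` with `x - l ∈ Ω`, and `l ↦ -l` maps these onto `Λ_x`. -/
theorem IsKTile.encard_latticeAt (hΩ : IsKTile M k Ω) :
    ∀ᵐ x : Fin d → ℝ, (latticeAt M Ω x).encard = (k : ℕ∞) := by
  filter_upwards [hΩ.tiles] with x hx
  have h1 : ∑' l : lattice M, Ω.indicator (fun _ => (1 : ℝ≥0∞)) (x - (l : Fin d → ℝ)) =
      (({l : lattice M | x - (l : Fin d → ℝ) ∈ Ω} : Set (lattice M)).encard : ℝ≥0∞) := by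
    rw [← ENNReal.tsum_set_one, tsum_subtype _ fun _ => (1 : ℝ≥0∞)]
    refine tsum_congr fun l => ?_
    by_cases hl : x - (l : Fin d → ℝ) ∈ Ω <;> simp [hl]
  have h2 : latticeAt M Ω x = (fun l : lattice M => -(l : Fin d → ℝ)) ''
      {l : lattice M | x - (l : Fin d → ℝ) ∈ Ω} := by
    ext y
    constructor
    · rintro ⟨hy, hxy⟩
      exact ⟨⟨-y, (latticeSubgroup M).neg_mem hy⟩,
        by simpa using hxy, by simp⟩
    · rintro ⟨l, hl, rfl⟩
      exact ⟨(latticeSubgroup M).neg_mem l.2,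
        by simpa [sub_eq_add_neg] using hl⟩
  rw [h2, Set.InjOn.encard_image fun l _ l' _ h => Subtype.ext (neg_injective h)]
  rw [h1] at hx
  exact_mod_cast hx

/-- For `x ∈ Ω` the set `Λ_x` contains `0`; were `k = 0`, this would make `Ω` null. -/
theorem IsKTile.ne_zero (hΩ : IsKTile M k Ω) : k ≠ 0 := by
  rintro rfl
  refine hΩ.pos.ne' ?_
  refine measure_mono_null ?_ hΩ.encard_latticeAt
  intro x hx (h : (latticeAt M Ω x).encard = _)
  rw [Nat.cast_zero, Set.encard_eq_zero] at h
  have : (0 : Fin d → ℝ) ∈ latticeAt M Ω x := ⟨(latticeSubgroup M).zero_mem, by simpa using hx⟩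
  simp [h] at this

theorem V_apply (a lam : Fin k → Fin d → ℝ) (s r : Fin k) :
    V a lam s r = expFun (-(a s)) (lam r) := by
  rw [V, Matrix.of_apply, expFun, neg_dotProduct, dotProduct_comm]
  congr 1
  push_cast
  ring

/-- A left inverse of a square matrix is a right inverse. The rows of `V` belong to the shifts, so
orthogonality of exponentials needs this row form. -/
theorem mul_conjTranspose_eq_of_conjTranspose_mul_eq {A : Matrix (Fin k) (Fin k) ℂ} (hk : k ≠ 0)
    (h : Aᴴ * A = (k : ℂ) • (1 : Matrix (Fin k) (Fin k) ℂ)) :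
    A * Aᴴ = (k : ℂ) • (1 : Matrix (Fin k) (Fin k) ℂ) := by
  have hk' : (k : ℂ) ≠ 0 := Nat.cast_ne_zero.mpr hk
  have h1 : ((k : ℂ)⁻¹ • Aᴴ) * A = 1 := by
    rw [Matrix.smul_mul, h, smul_smul, inv_mul_cancel₀ hk', one_smul]
  have h2 := mul_eq_one_comm.mp h1
  rw [Matrix.mul_smul] at h2
  rw [← h2, smul_smul, mul_inv_cancel₀ hk', one_smul]

theorem tsum_indicator_latticeAt {x : Fin d → ℝ} {lam : Fin k → Fin d → ℝ}
    (hinj : Function.Injective lam) (hrange : Set.range lam = latticeAt M Ω x)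
    (f : (Fin d → ℝ) → ℂ) :
    ∑' g : latticeSubgroup M, Ω.indicator f (x + g) = ∑ r, f (x + lam r) := by
  have hmem : ∀ r, lam r ∈ latticeAt M Ω x := fun r => hrange ▸ Set.mem_range_self r
  let i : Fin k → latticeSubgroup M := fun r => ⟨lam r, (hmem r).1⟩
  have hi : Function.Injective i := fun r r' h => hinj (congrArg Subtype.val h)
  rw [← hi.tsum_eq, tsum_fintype]
  · exact Finset.sum_congr rfl fun r _ => Set.indicator_of_mem (hmem r).2 _
  · intro g hg
    have hg' : x + (g : Fin d → ℝ) ∈ Ω := Set.mem_of_indicator_ne_zero hg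
    have : (g : Fin d → ℝ) ∈ Set.range lam := hrange ▸ ⟨g.2, hg'⟩
    obtain ⟨r, hr⟩ := this
    exact ⟨r, Subtype.ext hr⟩

theorem dualLattice_sub_mem {y y' : Fin d → ℝ} (hy : y ∈ dualLattice M)
    (hy' : y' ∈ dualLattice M) : y - y' ∈ dualLattice M := by
  obtain ⟨z, rfl⟩ := hy
  obtain ⟨w, rfl⟩ := hy'
  refine ⟨z - w, ?_⟩
  rw [← Matrix.mulVec_sub]
  congr 1
  ext i
  simp

theorem dualLattice_neg_mem {y : Fin d → ℝ} (hy : y ∈ dualLattice M) : -y ∈ dualLattice M := by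
  obtain ⟨z, rfl⟩ := hy
  refine ⟨-z, ?_⟩
  rw [← Matrix.mulVec_neg]
  congr 1
  ext i
  simp

/-- The inner products of exponentials over a multi-tile. -/
theorem IsKTile.setIntegral_expFun_sub (hΩ : IsKTile M k Ω) (hM : M.det ≠ 0)
    {a : Fin k → Fin d → ℝ}
    (hV : ∀ᵐ x ∂(volume.restrict (fundDomain M)), ∃ lam : Fin k → Fin d → ℝ,
      Function.Injective lam ∧ Set.range lam = latticeAt M Ω x ∧
      (V a lam)ᴴ * V a lam = (k : ℂ) • (1 : Matrix (Fin k) (Fin k) ℂ))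
    {y y' : Fin d → ℝ} (hy : y ∈ dualLattice M) (hy' : y' ∈ dualLattice M) (s t : Fin k)
    (hne : y + a s ≠ y' + a t) :
    ∫ x in Ω, expFun ((y' + a t) - (y + a s)) x = 0 := by
  set l := (y' + a t) - (y + a s) with hl
  have hF : Integrable (Ω.indicator (expFun l)) := by
    have : IsFiniteMeasure (volume.restrict Ω) := ⟨by simpa using hΩ.finite⟩
    refine IntegrableOn.integrable_indicator₀ ?_ hΩ.measurable
    exact Integrable.of_bound (continuous_expFun l).aestronglyMeasurable 1
      (Eventually.of_forall fun x => (norm_expFun l x).le)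
  rw [← integral_indicator₀ hΩ.measurable, ← (integrable_tsum_lattice hM hF).2]
  -- Since `y' - y` pairs trivially with `Λ`, the periodization equals `(VV*)_{st} e_l(x)`. It
  -- vanishes for `s ≠ t`; for `s = t` it is a multiple of a nontrivial character, whose integral is
  -- zero.
  have hsum : ∀ᵐ x ∂(volume.restrict (fundDomain M)),
      ∑' g : latticeSubgroup M, Ω.indicator (expFun l) (x + g) =
        (if s = t then (k : ℂ) else 0) * expFun l x := by
    filter_upwards [hV] with x ⟨lam, hinj, hrange, hVV⟩
    have hVV' := congrFun (congrFun
      (mul_conjTranspose_eq_of_conjTranspose_mul_eq hΩ.ne_zero hVV) s) t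
    rw [Matrix.smul_apply, Matrix.one_apply, smul_eq_mul, mul_ite, mul_one, mul_zero,
      Matrix.mul_apply] at hVV'
    rw [tsum_indicator_latticeAt hinj hrange, ← hVV', Finset.sum_mul]
    refine Finset.sum_congr rfl fun r _ => ?_
    have hr : lam r ∈ lattice M := (show lam r ∈ latticeAt M Ω x from hrange ▸ ⟨r, rfl⟩).1
    rw [Matrix.conjTranspose_apply, V_apply, V_apply, expFun_add_right, ← starRingEnd_apply,
      conj_expFun, neg_neg, ← expFun_add_left, mul_comm]
    congr 1
    rw [show l = (y' - y) + (-a s + a t) by rw [hl]; abel, expFun_add_left,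
      expFun_eq_one_of_mem hM (dualLattice_sub_mem hy' hy) hr, one_mul]
  rw [integral_congr_ae hsum, integral_const_mul]
  by_cases hst : s = t
  · subst hst
    have hl' : l = y' - y := by rw [hl]; abel
    rw [hl', integral_expFun_fundDomain hM (dualLattice_sub_mem hy' hy), mul_zero]
    intro h
    exact hne (by rw [sub_eq_zero.mp h])
  · rw [if_neg hst, zero_mul]

/-- A function on a multi-tile that is orthogonal to all the exponentials vanishes. -/
theorem IsKTile.ae_eq_zero_of_integral_mul_expFun (hΩ : IsKTile M k Ω) (hM : M.det ≠ 0)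
    {a : Fin k → Fin d → ℝ}
    (hV : ∀ᵐ x ∂(volume.restrict (fundDomain M)), ∃ lam : Fin k → Fin d → ℝ,
      Function.Injective lam ∧ Set.range lam = latticeAt M Ω x ∧
      (V a lam)ᴴ * V a lam = (k : ℂ) • (1 : Matrix (Fin k) (Fin k) ℂ))
    {f : (Fin d → ℝ) → ℂ} (hf : Integrable f (volume.restrict Ω))
    (h : ∀ y ∈ dualLattice M, ∀ s, ∫ x in Ω, f x * expFun (-(y + a s)) x = 0) :
    ∀ᵐ x ∂(volume.restrict Ω), f x = 0 := by
  have hint : ∀ l, Integrable (Ω.indicator fun x => f x * expFun l x) := fun l =>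
    IntegrableOn.integrable_indicator₀ (hf.mul_bdd (c := 1)
      (continuous_expFun l).aestronglyMeasurable
      (Eventually.of_forall fun x => (norm_expFun l x).le)) hΩ.measurable
  -- By unfolding, the integral of this periodization against `e_y` is the hypothesis at frequency
  -- `-y + a_s`; uniqueness of Fourier series applies for each of the finitely many `s`.
  have hzero : ∀ᵐ x ∂(volume.restrict (fundDomain M)), ∀ s,
      ∑' g : latticeSubgroup M, Ω.indicator (fun x => f x * expFun (-(a s)) x) (x + g) = 0 := by
    rw [ae_all_iff]
    intro s
    refine ae_eq_zero_of_integral_mul_expFun_eq_zero hM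
      (integrable_tsum_lattice hM (hint _)).1 fun y hy => ?_
    rw [← h (-y) (dualLattice_neg_mem hy) s, ← integral_indicator₀ hΩ.measurable,
      ← (integrable_tsum_lattice hM (hint _)).2]
    congr 1
    funext x
    rw [← tsum_mul_right]
    refine tsum_congr fun g => ?_
    by_cases hg : x + (g : Fin d → ℝ) ∈ Ω
    · rw [Set.indicator_of_mem hg, Set.indicator_of_mem hg,
        show -(-y + a s) = -(a s) + y by abel, expFun_add_left, expFun_add_lattice hM hy g.2]
      ring
    · rw [Set.indicator_of_notMem hg, Set.indicator_of_notMem hg, zero_mul]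
  rw [ae_restrict_iff'₀ hΩ.measurable]
  refine ae_of_ae_fundDomain_forall_lattice hM ?_
  filter_upwards [hV, hzero] with x ⟨lam, hinj, hrange, hVV⟩ hx g hg hxg
  -- The periodization at `x` is `e_{-a_s}(x) (V f_x)_s`, and the first factor has modulus one.
  -- Applying `V*` then kills `f_x`.
  have hVf : V a lam *ᵥ (fun r => f (x + lam r)) = 0 := by
    funext s
    have hs := hx s
    rw [tsum_indicator_latticeAt hinj hrange] at hs
    have : expFun (-(a s)) x * (V a lam *ᵥ fun r => f (x + lam r)) s = 0 := by
      rw [← hs, Matrix.mulVec, dotProduct, Finset.mul_sum]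
      refine Finset.sum_congr rfl fun r _ => ?_
      rw [V_apply, expFun_add_right]
      ring
    refine (mul_eq_zero.mp this).resolve_left ?_
    rw [← ne_eq, ← norm_ne_zero_iff, norm_expFun]
    exact one_ne_zero
  have hkf : (k : ℂ) • (fun r => f (x + lam r)) = 0 := by
    have := congrArg (fun w => (V a lam)ᴴ *ᵥ w) hVf
    simpa only [Matrix.mulVec_mulVec, hVV, Matrix.smul_mulVec, Matrix.one_mulVec,
      Matrix.mulVec_zero] using this
  have hf0 := (smul_eq_zero.mp hkf).resolve_left (Nat.cast_ne_zero.mpr hΩ.ne_zero)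
  obtain ⟨r, rfl⟩ : g ∈ Set.range lam := hrange ▸ ⟨hg, hxg⟩
  exact congrFun hf0 r

theorem IsKTile.isOrthogonalBasisOfExponentials (hΩ : IsKTile M k Ω) (hM : M.det ≠ 0)
    {a : Fin k → Fin d → ℝ}
    (hV : ∀ᵐ x ∂(volume.restrict (fundDomain M)), ∃ lam : Fin k → Fin d → ℝ,
      Function.Injective lam ∧ Set.range lam = latticeAt M Ω x ∧
      (V a lam)ᴴ * V a lam = (k : ℂ) • (1 : Matrix (Fin k) (Fin k) ℂ)) :
    IsOrthogonalBasisOfExponentials Ω (frequencies M a) := by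
  have : IsFiniteMeasure (volume.restrict Ω) := ⟨by simpa using hΩ.finite⟩
  have hpos : 0 < volume.real Ω := ENNReal.toReal_pos hΩ.pos.ne' hΩ.finite.ne
  set c : ℂ := ((Real.sqrt (volume.real Ω) : ℝ) : ℂ) with hc
  have hc0 : c ≠ 0 := by
    rw [hc, Complex.ofReal_ne_zero]
    exact (Real.sqrt_pos.mpr hpos).ne'
  have hcc : c * c = (volume.real Ω : ℂ) := by
    rw [hc, ← Complex.ofReal_mul, Real.mul_self_sqrt hpos.le]
  have hcconj : (starRingEnd ℂ) c⁻¹ = c⁻¹ := by rw [map_inv₀, hc, Complex.conj_ofReal]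
  have hmem : ∀ l : Fin d → ℝ, MemLp (fun x => c⁻¹ * expFun l x) 2 (volume.restrict Ω) := fun l =>
    MemLp.of_bound ((continuous_expFun l).aestronglyMeasurable.const_mul _) ‖c⁻¹‖
      (Eventually.of_forall fun x => by rw [norm_mul, norm_expFun, mul_one])
  let v : frequencies M a → Lp ℂ 2 (volume.restrict Ω) := fun l => (hmem l).toLp _
  have hv : ∀ l : frequencies M a, v l =ᵐ[volume.restrict Ω] fun x => c⁻¹ * expFun l x :=
    fun l => (hmem l).coeFn_toLp
  have hinner : ∀ (l : frequencies M a) (f : Lp ℂ 2 (volume.restrict Ω)),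
      inner ℂ (v l) f = c⁻¹ * ∫ x in Ω, f x * expFun (-(l : Fin d → ℝ)) x := by
    intro l f
    rw [L2.inner_def, ← integral_const_mul]
    refine integral_congr_ae ?_
    filter_upwards [hv l] with x hx
    rw [RCLike.inner_apply, hx, map_mul, hcconj, conj_expFun]
    ring
  have horth : Orthonormal ℂ v := by
    rw [orthonormal_iff_ite]
    intro l l'
    have h1 : inner ℂ (v l) (v l') =
        c⁻¹ * c⁻¹ * ∫ x in Ω, expFun ((l' : Fin d → ℝ) - (l : Fin d → ℝ)) x := by
      rw [hinner, mul_assoc, ← integral_const_mul (c⁻¹) fun x =>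
        expFun ((l' : Fin d → ℝ) - (l : Fin d → ℝ)) x]
      congr 1
      refine integral_congr_ae ?_
      filter_upwards [hv l'] with x hx
      rw [hx, mul_assoc, ← expFun_add_left, sub_eq_add_neg]
    rw [h1]
    split_ifs with hll
    · subst hll
      simp only [sub_self, expFun_zero_left, setIntegral_const, Complex.real_smul, mul_one]
      rw [← mul_inv, hcc, inv_mul_cancel₀]
      exact_mod_cast hpos.ne'
    · obtain ⟨l, hl⟩ := l
      obtain ⟨l', hl'⟩ := l'
      obtain ⟨s, y, hy, rfl⟩ := Set.mem_iUnion.mp hl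
      obtain ⟨t, y', hy', rfl⟩ := Set.mem_iUnion.mp hl'
      have hne : y + a s ≠ y' + a t := fun h => hll (Subtype.ext h)
      rw [hΩ.setIntegral_expFun_sub hM hV hy hy' s t hne, mul_zero]
  have hspan : (Submodule.span ℂ (Set.range v))ᗮ = ⊥ := by
    rw [Submodule.eq_bot_iff]
    intro f hf
    rw [Submodule.mem_orthogonal] at hf
    have hf1 : Integrable f (volume.restrict Ω) := (Lp.memLp f).integrable one_le_two
    have hf0 := hΩ.ae_eq_zero_of_integral_mul_expFun hM hV hf1 fun y hy s => by
      have hl : y + a s ∈ frequencies M a := Set.mem_iUnion.mpr ⟨s, y, hy, rfl⟩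
      have h0 := hf (v ⟨_, hl⟩) (Submodule.subset_span ⟨_, rfl⟩)
      rw [hinner] at h0
      exact (mul_eq_zero.mp h0).resolve_left (inv_ne_zero hc0)
    exact (Lp.eq_zero_iff_ae_eq_zero).mpr hf0
  refine ⟨HilbertBasis.mkOfOrthogonalEqBot horth hspan, fun l => ?_⟩
  rw [HilbertBasis.coe_mkOfOrthogonalEqBot]
  filter_upwards [hv l] with x hx
  rw [hx, mul_inv_cancel_left₀ hc0]

end

section

variable {d k : ℕ}

/-! ### Trees with prescribed numbers of children -/

theorem truncate_truncate (S : Set (Fin d → ℝ)) {l m : ℕ} (hlm : l ≤ m) (hm : m ≤ d) :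
    truncate (truncate S m hm) l hlm = truncate S l (hlm.trans hm) := by
  rw [truncate, truncate, Set.image_image]
  rfl

theorem truncate_self (S : Set (Fin d → ℝ)) : truncate S d le_rfl = S := by
  have : (fun (m : Fin d → ℝ) (i : Fin d) => m (Fin.castLE le_rfl i)) = id := rfl
  rw [truncate, this, Set.image_id]

theorem levelSet_truncate {m : ℕ} (S : Set (Fin (m + 1) → ℝ)) (l : Fin m)
    (p : Fin (l : ℕ) → ℝ) :
    levelSet (truncate S m (Nat.le_succ m)) l p = levelSet S l.castSucc p := by
  rw [levelSet, truncate_truncate]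
  rfl

theorem levelSet_last {m : ℕ} (S : Set (Fin (m + 1) → ℝ)) (p : Fin m → ℝ) :
    levelSet S (Fin.last m) p = children S p :=
  congrArg (fun T => children T p) (truncate_self S)

theorem shiftIndexSet_empty (m : ℕ) : shiftIndexSet m ∅ = ∅ := by
  induction m with
  | zero => ext j; simp [shiftIndexSet]
  | succ m ih => ext j; simp [shiftIndexSet, truncate, ih]

/-- If all the nodes of level `l` have `c l` children, then the shift index set is a box. -/
theorem shiftIndexSet_eq_box (m : ℕ) (S : Set (Fin m → ℝ)) (c : Fin m → ℕ) (hS : S.Nonempty)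
    (h : ∀ l : Fin m, ∀ p ∈ truncate S (l : ℕ) l.isLt.le, (levelSet S l p).encard = (c l : ℕ∞)) :
    shiftIndexSet m S = {j | ∀ l, j l < c l} := by
  induction m with
  | zero =>
    ext j
    simp [shiftIndexSet, hS]
  | succ m ih =>
    have hch : ∀ p ∈ truncate S m (Nat.le_succ m),
        (children S p).encard = (c (Fin.last m) : ℕ∞) := fun p hp => by
      rw [← levelSet_last]
      exact h (Fin.last m) p hp
    have hbox := ih (truncate S m (Nat.le_succ m)) (fun l => c l.castSucc) (hS.image _)
      fun l p hp => by
        rw [truncate_truncate] at hp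
        rw [levelSet_truncate]
        exact h l.castSucc p hp
    ext j
    simp only [shiftIndexSet, Set.mem_ofPred_eq, Fin.forall_fin_succ']
    -- With a constant number of children the recursion is all or nothing: either every node has
    -- more than `j (Fin.last m)` children, or none has.
    by_cases hj : j (Fin.last m) < c (Fin.last m)
    · have hset : {p | p ∈ truncate S m (Nat.le_succ m) ∧
          (j (Fin.last m) : ℕ∞) < (children S p).encard} = truncate S m (Nat.le_succ m) := by
        ext p
        refine ⟨fun hp => hp.1, fun hp => ⟨hp, ?_⟩⟩
        rw [hch p hp]
        exact_mod_cast hj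
      rw [hset, hbox]
      simp [hj]
    · have hset : {p | p ∈ truncate S m (Nat.le_succ m) ∧
          (j (Fin.last m) : ℕ∞) < (children S p).encard} = ∅ := by
        ext p
        refine ⟨fun ⟨hp, hlt⟩ => hj ?_, fun hp => hp.elim⟩
        rw [hch p hp] at hlt
        exact_mod_cast hlt
      rw [hset, shiftIndexSet_empty]
      simp [hj]

/-! ### Residues and the digits of a perfect tree -/

theorem exists_realMod_eq (y : ℝ) {q : ℕ} : ∃ n : ℤ, y = realMod y q + q * n :=
  ⟨⌊y / q⌋, by rw [realMod]; ring⟩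

theorem realMod_nonneg (y : ℝ) {q : ℕ} (hq : 0 < q) : 0 ≤ realMod y q := by
  have hq' : (0 : ℝ) < q := Nat.cast_pos.mpr hq
  rw [realMod, sub_nonneg, mul_comm]
  exact (le_div_iff₀ hq').mp (Int.floor_le _)

theorem realMod_lt (y : ℝ) {q : ℕ} (hq : 0 < q) : realMod y q < q := by
  have hq' : (0 : ℝ) < q := Nat.cast_pos.mpr hq
  have := (div_lt_iff₀ hq').mp (Int.lt_floor_add_one (y / q))
  rw [realMod]
  linarith

/-- The pointwise form of perfect admissibility, for the set `S = Λ_x`. -/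
structure IsPerfectTree (S : Set (Fin d → ℝ)) (v : Fin d → ℝ) (q : Fin d → ℕ) : Prop where
  pos : ∀ l, 0 < q l
  nonempty : S.Nonempty
  encard_image : ∀ l : Fin d, ∀ p ∈ truncate S (l : ℕ) l.isLt.le,
    ((fun z => realMod (v l * z) (q l)) '' levelSet S l p).encard = (levelSet S l p).encard
  integer : ∀ l : Fin d, ∀ p ∈ truncate S (l : ℕ) l.isLt.le,
    (fun z => realMod (v l * z) (q l)) '' levelSet S l p ⊆ Set.range (fun n : ℤ => (n : ℝ))
  encard_levelSet : ∀ l : Fin d, ∀ p ∈ truncate S (l : ℕ) l.isLt.le,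
    (levelSet S l p).encard = (q l : ℕ∞)

namespace IsPerfectTree

variable {S : Set (Fin d → ℝ)} {v : Fin d → ℝ} {q : Fin d → ℕ}

theorem finite_levelSet (h : IsPerfectTree S v q) (l : Fin d) {p : Fin (l : ℕ) → ℝ}
    (hp : p ∈ truncate S (l : ℕ) l.isLt.le) : (levelSet S l p).Finite :=
  Set.finite_of_encard_eq_coe (h.encard_levelSet l p hp)

theorem injOn (h : IsPerfectTree S v q) (l : Fin d) {p : Fin (l : ℕ) → ℝ}
    (hp : p ∈ truncate S (l : ℕ) l.isLt.le) :
    Set.InjOn (fun z => realMod (v l * z) (q l)) (levelSet S l p) :=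
  (h.finite_levelSet l hp).injOn_of_encard_image_eq (h.encard_image l p hp)

/-- Pigeonhole: `q l` distinct integers in `[0, q l)` exhaust that range. -/
theorem image_eq (h : IsPerfectTree S v q) (l : Fin d) {p : Fin (l : ℕ) → ℝ}
    (hp : p ∈ truncate S (l : ℕ) l.isLt.le) :
    (fun z => realMod (v l * z) (q l)) '' levelSet S l p =
      Set.range fun t : Fin (q l) => ((t : ℕ) : ℝ) := by
  refine ((h.finite_levelSet l hp).image _).eq_of_subset_of_encard_le ?_ ?_
  · rintro _ ⟨z, hz, rfl⟩
    obtain ⟨n, hn⟩ := h.integer l p hp ⟨z, hz, rfl⟩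
    have h0 := realMod_nonneg (v l * z) (h.pos l)
    have h1 := realMod_lt (v l * z) (h.pos l)
    simp only at hn ⊢
    rw [← hn] at h0 h1 ⊢
    have h0' : 0 ≤ n := by exact_mod_cast h0
    lift n to ℕ using h0'
    exact ⟨⟨n, by exact_mod_cast h1⟩, by simp⟩
  · rw [h.encard_image l p hp, h.encard_levelSet l p hp, ← Set.image_univ]
    refine (Set.encard_image_le _ _).trans ?_
    simp [Set.encard_univ]

/-- An ordering of the children of a node by their residues. -/
theorem exists_children (h : IsPerfectTree S v q) (l : Fin d) {p : Fin (l : ℕ) → ℝ}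
    (hp : p ∈ truncate S (l : ℕ) l.isLt.le) :
    ∃ z : Fin (q l) → ℝ, Function.Injective z ∧ Set.range z = levelSet S l p ∧
      ∀ t, realMod (v l * z t) (q l) = ((t : ℕ) : ℝ) := by
  have hex : ∀ t : Fin (q l), ∃ z ∈ levelSet S l p, realMod (v l * z) (q l) = ((t : ℕ) : ℝ) :=
    fun t => by
      have : ((t : ℕ) : ℝ) ∈ (fun z => realMod (v l * z) (q l)) '' levelSet S l p :=
        (h.image_eq l hp).symm ▸ ⟨t, rfl⟩
      exact this
  choose z hz hzt using hex
  refine ⟨z, fun t t' htt => ?_, Set.Subset.antisymm (Set.range_subset_iff.mpr hz) ?_, hzt⟩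
  · have h1 := hzt t
    rw [htt, hzt t'] at h1
    exact Fin.ext (by exact_mod_cast h1.symm)
  · intro w hw
    have : realMod (v l * w) (q l) ∈ Set.range fun t : Fin (q l) => ((t : ℕ) : ℝ) :=
      (h.image_eq l hp) ▸ ⟨w, hw, rfl⟩
    obtain ⟨t, ht⟩ := this
    exact ⟨t, h.injOn l hp (hz t) hw ((hzt t).trans ht)⟩

theorem coord_mem_levelSet {m : Fin d → ℝ} (hm : m ∈ S) (l : Fin d) :
    m l ∈ levelSet S l fun i => m (Fin.castLE l.isLt.le i) := by
  refine ⟨m, hm, ?_⟩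
  funext i
  refine Fin.lastCases ?_ (fun i => ?_) i
  · rw [Fin.snoc_last]
    rfl
  · rw [Fin.snoc_castSucc]
    rfl

theorem exists_digit (h : IsPerfectTree S v q) {m : Fin d → ℝ} (hm : m ∈ S) (l : Fin d) :
    ∃ t : Fin (q l), realMod (v l * m l) (q l) = ((t : ℕ) : ℝ) := by
  have hp : (fun i => m (Fin.castLE l.isLt.le i)) ∈ truncate S (l : ℕ) l.isLt.le := ⟨m, hm, rfl⟩
  have : realMod (v l * m l) (q l) ∈ Set.range fun t : Fin (q l) => ((t : ℕ) : ℝ) :=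
    (h.image_eq l hp) ▸ ⟨m l, coord_mem_levelSet hm l, rfl⟩
  obtain ⟨t, ht⟩ := this
  exact ⟨t, ht.symm⟩

/-- Once the earlier coordinates agree, `m l` and `m' l` are children of the same node, and siblings
are separated by their residues. -/
theorem eq_of_realMod_eq (h : IsPerfectTree S v q) {m m' : Fin d → ℝ} (hm : m ∈ S) (hm' : m' ∈ S)
    (hmm : ∀ l, realMod (v l * m l) (q l) = realMod (v l * m' l) (q l)) : m = m' := by
  have key : ∀ n : ℕ, ∀ l : Fin d, (l : ℕ) = n → m l = m' l := by
    intro n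
    induction n using Nat.strong_induction_on with
    | _ n ih =>
      rintro l rfl
      have hpre : (fun i => m (Fin.castLE l.isLt.le i)) =
          fun i => m' (Fin.castLE l.isLt.le i) :=
        funext fun i => ih i i.isLt _ rfl
      have hl' := coord_mem_levelSet hm' l
      rw [← hpre] at hl'
      exact h.injOn l ⟨m, hm, rfl⟩ (coord_mem_levelSet hm l) hl' (hmm l)
  exact funext fun l => key l l rfl

/-- Descend from the root, taking at each level the child with the prescribed residue. -/
theorem exists_mem_of_digits (h : IsPerfectTree S v q) (t : (l : Fin d) → Fin (q l)) :
    ∃ m ∈ S, ∀ l, realMod (v l * m l) (q l) = ((t l : ℕ) : ℝ) := by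
  have key : ∀ n (hn : n ≤ d), ∃ p ∈ truncate S n hn, ∀ i : Fin n,
      realMod (v (Fin.castLE hn i) * p i) (q (Fin.castLE hn i)) =
        ((t (Fin.castLE hn i) : ℕ) : ℝ) := by
    intro n
    induction n with
    | zero =>
      intro hn
      obtain ⟨m, hm⟩ := h.nonempty
      exact ⟨_, ⟨m, hm, rfl⟩, fun i => i.elim0⟩
    | succ n ih =>
      intro hn
      obtain ⟨p, hp, hpt⟩ := ih (Nat.le_of_succ_le hn)
      obtain ⟨z, -, hz, hzt⟩ := h.exists_children ⟨n, hn⟩ hp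
      have hmem : z (t ⟨n, hn⟩) ∈ levelSet S ⟨n, hn⟩ p := hz ▸ ⟨_, rfl⟩
      refine ⟨Fin.snoc p (z (t ⟨n, hn⟩)), hmem, fun i => ?_⟩
      refine Fin.lastCases ?_ (fun i => ?_) i
      · rw [Fin.snoc_last]
        exact hzt _
      · rw [Fin.snoc_castSucc]
        exact hpt i
  obtain ⟨m, hm, hmt⟩ := key d le_rfl
  rw [truncate_self] at hm
  exact ⟨m, hm, hmt⟩

/-- The elements of a perfect tree are parametrized by their digits. -/
theorem exists_parametrization (h : IsPerfectTree S v q) :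
    ∃ L : ((l : Fin d) → Fin (q l)) → Fin d → ℝ, Function.Injective L ∧ Set.range L = S ∧
      ∀ t l, realMod (v l * L t l) (q l) = ((t l : ℕ) : ℝ) := by
  choose L hL hLt using h.exists_mem_of_digits
  refine ⟨L, fun t t' htt => ?_, Set.Subset.antisymm (Set.range_subset_iff.mpr hL) ?_, hLt⟩
  · funext l
    have h1 := hLt t l
    rw [htt, hLt t' l] at h1
    exact Fin.ext (by exact_mod_cast h1.symm)
  · intro m hm
    choose t ht using h.exists_digit hm
    exact ⟨t, h.eq_of_realMod_eq (hL t) hm fun l => (hLt t l).trans (ht l).symm⟩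

theorem encard_eq (h : IsPerfectTree S v q) : S.encard = ((∏ l, q l : ℕ) : ℕ∞) := by
  obtain ⟨L, hinj, hrange, -⟩ := h.exists_parametrization
  rw [← hrange, ← Set.image_univ, hinj.injOn.encard_image, Set.encard_univ]
  simp

theorem shiftIndexSet_eq (h : IsPerfectTree S v q) :
    shiftIndexSet d S = {j | ∀ l, j l < q l} :=
  shiftIndexSet_eq_box d S q h.nonempty h.encard_levelSet

end IsPerfectTree

/-! ### Discrete Fourier matrices -/

theorem W_apply {n : ℕ} (δ : ℝ) (z : Fin n → ℝ) (s t : Fin n) :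
    W δ z s t = Complex.exp (-(2 * (Real.pi : ℂ) * Complex.I * ((δ * z t * (s : ℕ) : ℝ) : ℂ))) := by
  rw [W, Matrix.transpose_apply, Matrix.vandermonde_apply, ← Complex.exp_nat_mul]
  congr 1
  push_cast
  ring

theorem exp_neg_two_pi_I_mul_eq {x y : ℝ} (n : ℤ) (h : x = y + n) :
    Complex.exp (-(2 * (Real.pi : ℂ) * Complex.I * (x : ℂ))) =
      Complex.exp (-(2 * (Real.pi : ℂ) * Complex.I * (y : ℂ))) := by
  rw [Complex.exp_eq_exp_iff_exists_int]
  refine ⟨-n, ?_⟩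
  rw [h]
  push_cast
  ring

/-- Division by `q` turns a congruence modulo `q` into one modulo `1`, which is all that the
exponential sees. -/
theorem div_mul_eq_add_int {q : ℕ} (hq : 0 < q) {v z t : ℝ} (h : realMod (v * z) q = t) :
    ∃ n : ℤ, v / q * z = 1 / q * t + n := by
  obtain ⟨n, hn⟩ := exists_realMod_eq (v * z) (q := q)
  refine ⟨n, ?_⟩
  have hq' : (q : ℝ) ≠ 0 := Nat.cast_ne_zero.mpr hq.ne'
  rw [h] at hn
  field_simp
  linarith

theorem W_eq_dft {q : ℕ} {v : ℝ} {z : Fin q → ℝ}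
    (h : ∀ t, realMod (v * z t) q = ((t : ℕ) : ℝ)) : W (v / q) z = dft q := by
  ext s t
  obtain ⟨n, hn⟩ := div_mul_eq_add_int (t.pos) (h t)
  rw [dft, W_apply, W_apply]
  refine exp_neg_two_pi_I_mul_eq (n * (s : ℕ)) ?_
  rw [hn]
  push_cast
  ring

/-- Each entry is a geometric sum in a `q`-th root of unity `w`. Off the diagonal `w ≠ 1`, as `0 <
|t - t'| < q`, and the sum vanishes. -/
theorem conjTranspose_dft_mul_dft (q : ℕ) : (dft q)ᴴ * dft q = (q : ℂ) • 1 := by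
  ext t t'
  have hq : (q : ℂ) ≠ 0 := Nat.cast_ne_zero.mpr t.pos.ne'
  set w : ℂ := Complex.exp (2 * Real.pi * Complex.I * ((t : ℕ) - (t' : ℕ) : ℤ) / q) with hw
  have hsum : ((dft q)ᴴ * dft q) t t' = ∑ s ∈ Finset.range q, w ^ s := by
    rw [Matrix.mul_apply, Finset.sum_range]
    refine Finset.sum_congr rfl fun s _ => ?_
    rw [Matrix.conjTranspose_apply, ← starRingEnd_apply, dft, W_apply, W_apply,
      ← Complex.exp_conj, ← Complex.exp_add, hw, ← Complex.exp_nat_mul]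
    congr 1
    simp only [map_neg, map_mul, Complex.conj_I, Complex.conj_ofReal, map_ofNat]
    push_cast
    ring
  rw [hsum, Matrix.smul_apply, Matrix.one_apply, smul_eq_mul]
  by_cases htt : t = t'
  · subst htt
    simp [hw]
  · have hwq : w ^ q = 1 := by
      rw [hw, ← Complex.exp_nat_mul, Complex.exp_eq_one_iff]
      exact ⟨(t : ℕ) - (t' : ℕ), by field_simp⟩
    have hw1 : w ≠ 1 := by
      rw [hw, Ne, Complex.exp_eq_one_iff]
      rintro ⟨n, hn⟩
      have hn' : (((t : ℕ) - (t' : ℕ) : ℤ) : ℂ) = ((n * q : ℤ) : ℂ) := by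
        have h2 := Complex.two_pi_I_ne_zero
        rw [div_eq_iff hq] at hn
        refine mul_left_cancel₀ h2 ?_
        rw [hn]
        push_cast
        ring
      have hn'' : ((t : ℕ) : ℤ) - (t' : ℕ) = n * q := by exact_mod_cast hn'
      have h0 : ((t : ℕ) : ℤ) - (t' : ℕ) = 0 :=
        Int.eq_zero_of_abs_lt_dvd ⟨n, by rw [hn'', mul_comm]⟩
          (by rw [abs_lt]; constructor <;> have := t.isLt <;> have := t'.isLt <;> omega)
      exact htt (Fin.ext (by omega))
    rw [if_neg htt, mul_zero]
    refine (mul_eq_zero.mp ?_).resolve_left (sub_ne_zero.mpr hw1)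
    rw [mul_geom_sum, hwq, sub_self]

/-- By distributivity the sum over tuples of products is the product of the sums over single
indices, so each entry factors over `l`. -/
theorem conjTranspose_kroneckerProd_mul {q : Fin d → ℕ} (c : Fin d → ℂ)
    (A : (l : Fin d) → Matrix (Fin (q l)) (Fin (q l)) ℂ) (h : ∀ l, (A l)ᴴ * A l = c l • 1) :
    (kroneckerProd A)ᴴ * kroneckerProd A = (∏ l, c l) • 1 := by
  ext t t'
  have h1 : ((kroneckerProd A)ᴴ * kroneckerProd A) t t' = ∏ l, ((A l)ᴴ * A l) (t l) (t' l) := by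
    simp only [Matrix.mul_apply, Matrix.conjTranspose_apply, kroneckerProd, Matrix.of_apply,
      star_prod, ← Finset.prod_mul_distrib]
    rw [Finset.prod_univ_sum, Fintype.piFinset_univ]
  rw [h1]
  simp only [h, Matrix.smul_apply, Matrix.one_apply, smul_eq_mul, mul_ite, mul_one, mul_zero]
  by_cases htt : t = t'
  · simp [htt]
  · obtain ⟨l, hl⟩ := Function.ne_iff.mp htt
    rw [if_neg htt]
    exact Finset.prod_eq_zero (Finset.mem_univ l) (if_neg hl)

end

/-! ### Kronecker structure of `V` and construction of the shifts -/

section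

variable {d k : ℕ} {M : Matrix (Fin d) (Fin d) ℝ} {Ω : Set (Fin d → ℝ)} {v : Fin d → ℝ}
  {q : Fin d → ℕ} {η : Fin d → ℝ}

/-- Admissibility is vacuous at an empty `Λ_x`; nonemptiness comes from `#Λ_x = k ≠ 0`. -/
theorem IsPerfectlyAdmissibleWith.ae_isPerfectTree (h : IsPerfectlyAdmissibleWith M Ω v q)
    (hΩ : IsKTile M k Ω) :
    ∀ᵐ x ∂(volume.restrict (fundDomain M)), IsPerfectTree (latticeAt M Ω x) v q := by
  filter_upwards [h.1.1.2, h.1.2, h.2, ae_restrict_of_ae hΩ.encard_latticeAt] with x h1 h2 h3 h4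
  refine ⟨h.1.1.1, ?_, h1, h2, h3⟩
  rw [← Set.encard_ne_zero, h4]
  exact_mod_cast hΩ.ne_zero

/-- The exponentials at shifted frequencies are products of entries of Fourier matrices. -/
theorem exp_dotProduct_eq_prod_dft (hM : M.det ≠ 0) (hη : η ∈ dualLattice M) {m a : Fin d → ℝ}
    (hm : m ∈ lattice M) {j t : (l : Fin d) → Fin (q l)}
    (hmt : ∀ l, realMod (v l * m l) (q l) = ((t l : ℕ) : ℝ))
    (ha : ∀ l, a l = v l / (q l : ℝ) * ((j l : ℕ) : ℝ) + η l) :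
    Complex.exp (-(2 * (Real.pi : ℂ) * Complex.I * ((m ⬝ᵥ a : ℝ) : ℂ))) =
      ∏ l, dft (q l) (j l) (t l) := by
  choose n hn using fun l => div_mul_eq_add_int (t l).pos (hmt l)
  obtain ⟨n', hn'⟩ := exists_int_dotProduct hM hη hm
  -- The integer error collects `n l * j l`, from replacing `v l * m l` by its residue, and `n' =
  -- η·m`.
  have hsum : m ⬝ᵥ a = (∑ l, 1 / (q l : ℝ) * ((t l : ℕ) : ℝ) * ((j l : ℕ) : ℝ)) +
      ((∑ l, n l * (j l : ℕ) + n' : ℤ) : ℝ) := by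
    push_cast
    rw [← hn', ← add_assoc, ← Finset.sum_add_distrib, dotProduct, dotProduct,
      ← Finset.sum_add_distrib]
    refine Finset.sum_congr rfl fun l _ => ?_
    rw [ha]
    linear_combination ((j l : ℕ) : ℝ) * hn l
  rw [exp_neg_two_pi_I_mul_eq _ hsum]
  simp only [dft, W_apply, ← Complex.exp_sum]
  congr 1
  push_cast
  rw [Finset.sum_neg_distrib, Finset.mul_sum]

/-- The matrix of a perfect tree is a Kronecker product of Fourier matrices. -/
theorem IsPerfectTree.exists_reindex_V (hM : M.det ≠ 0) {S : Set (Fin d → ℝ)}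
    (h : IsPerfectTree S v q) (hS : S ⊆ lattice M) (hη : η ∈ dualLattice M)
    {a : Fin k → Fin d → ℝ} (J : Fin k ≃ ((l : Fin d) → Fin (q l)))
    (ha : ∀ s l, a s l = v l / (q l : ℝ) * ((J s l : ℕ) : ℝ) + η l)
    {lam : Fin k → Fin d → ℝ} (hinj : Function.Injective lam) (hrange : Set.range lam = S) :
    ∃ σ : Fin k ≃ ((l : Fin d) → Fin (q l)),
      Matrix.reindex J σ (V a lam) = kroneckerProd fun l => dft (q l) := by
  obtain ⟨L, hL, hLS, hLt⟩ := h.exists_parametrization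
  -- Sends `r` to the digits of `lam r`. Only this column labelling depends on the enumeration of
  -- `S`; the row labelling `J` is fixed in advance.
  let σ : Fin k ≃ ((l : Fin d) → Fin (q l)) := (Equiv.ofInjective lam hinj).trans
    ((Equiv.setCongr (hrange.trans hLS.symm)).trans (Equiv.ofInjective L hL).symm)
  have hσ : ∀ t, lam (σ.symm t) = L t := fun t => by
    have h1 : lam (σ.symm t) =
        (Equiv.ofInjective lam hinj (σ.symm t) : Set.range lam) := rfl
    rw [h1]
    simp [σ]
  refine ⟨σ, ?_⟩
  ext s t
  rw [Matrix.reindex_apply, Matrix.submatrix_apply, V, Matrix.of_apply, hσ, kroneckerProd,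
    Matrix.of_apply]
  exact exp_dotProduct_eq_prod_dft hM hη (hS (hLS ▸ ⟨t, rfl⟩)) (hLt t) fun l => by
    rw [ha, J.apply_symm_apply]

theorem conjTranspose_mul_self_of_reindex_eq {J σ : Fin k ≃ ((l : Fin d) → Fin (q l))}
    {A : Matrix (Fin k) (Fin k) ℂ}
    (h : Matrix.reindex J σ A = kroneckerProd fun l => dft (q l)) :
    Aᴴ * A = (k : ℂ) • (1 : Matrix (Fin k) (Fin k) ℂ) := by
  have hk : (∏ l, (q l : ℂ)) = k := by
    have := Fintype.card_congr J
    rw [Fintype.card_fin, Fintype.card_pi] at this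
    simp only [Fintype.card_fin] at this
    rw [this]
    push_cast
    rfl
  have hA : A = (kroneckerProd fun l => dft (q l)).submatrix J σ := by
    rw [← h]
    ext s r
    simp
  rw [hA, Matrix.conjTranspose_submatrix, Matrix.submatrix_mul_equiv,
    conjTranspose_kroneckerProd_mul (fun l => (q l : ℂ)) _ fun l => conjTranspose_dft_mul_dft _, hk]
  ext s r
  simp [Matrix.one_apply]

/-- Shifts congruent modulo `Λ*` would give equal rows of `V`, but distinct rows are orthogonal with
squared norm `k ≠ 0`. -/
theorem sub_notMem_dualLattice (hM : M.det ≠ 0) (hk : k ≠ 0) {a lam : Fin k → Fin d → ℝ}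
    (hlam : ∀ r, lam r ∈ lattice M)
    (hV : (V a lam)ᴴ * V a lam = (k : ℂ) • (1 : Matrix (Fin k) (Fin k) ℂ)) {s t : Fin k}
    (hst : s ≠ t) : a s - a t ∉ dualLattice M := by
  intro hmem
  have hrow : ∀ r, V a lam s r = V a lam t r := fun r => by
    rw [V_apply, V_apply, show -(a t) = (a s - a t) + -(a s) by abel, expFun_add_left,
      expFun_eq_one_of_mem hM hmem (hlam r), one_mul]
  have hVV := mul_conjTranspose_eq_of_conjTranspose_mul_eq hk hV
  have h1 := congrFun (congrFun hVV s) t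
  have h2 := congrFun (congrFun hVV t) t
  simp only [Matrix.mul_apply, hrow, Matrix.smul_apply, Matrix.one_apply, if_neg hst, smul_eq_mul,
    mul_zero, if_true, mul_one] at h1 h2
  rw [h1] at h2
  exact hk (by exact_mod_cast h2.symm)

/-- The shift index set of a perfect tree is the full box, so one choice of `a` serves all such `S`.
-/
theorem IsPerfectTree.range_eq_shiftSet {S : Set (Fin d → ℝ)} (h : IsPerfectTree S v q)
    {a : Fin k → Fin d → ℝ} (J : Fin k ≃ ((l : Fin d) → Fin (q l)))
    (ha : ∀ s l, a s l = v l / (q l : ℝ) * ((J s l : ℕ) : ℝ) + η l) :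
    Set.range a = shiftSet v q η S := by
  ext y
  simp only [shiftSet, h.shiftIndexSet_eq, Set.mem_range, Set.mem_ofPred_eq]
  constructor
  · rintro ⟨s, rfl⟩
    refine ⟨fun l => (J s l : ℕ), fun l => (J s l).isLt, ?_⟩
    funext l
    rw [ha, Pi.add_apply, Matrix.mulVec_diagonal]
  · rintro ⟨j, hj, rfl⟩
    refine ⟨J.symm fun l => ⟨j l, hj l⟩, ?_⟩
    funext l
    rw [ha, Pi.add_apply, Matrix.mulVec_diagonal, J.apply_symm_apply]

theorem exists_shifts (hM : M.det ≠ 0) (hΩ : IsKTile M k Ω)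
    (h : IsPerfectlyAdmissibleWith M Ω v q) (hη : η ∈ dualLattice M) :
    ∃ (a : Fin k → Fin d → ℝ) (J : Fin k ≃ ((l : Fin d) → Fin (q l))),
      (∀ s l, a s l = v l / (q l : ℝ) * (((J s l : Fin (q l)) : ℕ) : ℝ) + η l) ∧
      (∀ᵐ x ∂(volume.restrict (fundDomain M)),
        Set.range a = shiftSet v q η (latticeAt M Ω x)) ∧
      (∀ s t, s ≠ t → a s - a t ∉ dualLattice M) ∧
      IsOrthogonalBasisOfExponentials Ω (frequencies M a) ∧
      ∀ᵐ x ∂(volume.restrict (fundDomain M)),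
        (latticeAt M Ω x).encard = (k : ℕ∞) ∧
        (∀ l : Fin d, ∀ p ∈ truncate (latticeAt M Ω x) (l : ℕ) l.isLt.le,
          ∃ z : Fin (q l) → ℝ, Function.Injective z ∧
            Set.range z = levelSet (latticeAt M Ω x) l p ∧
            W (v l / (q l : ℝ)) z = dft (q l)) ∧
        ∀ lam : Fin k → Fin d → ℝ, Function.Injective lam →
          Set.range lam = latticeAt M Ω x →
            (∃ σ : Fin k ≃ ((l : Fin d) → Fin (q l)),
              Matrix.reindex J σ (V a lam) = kroneckerProd (fun l => dft (q l))) ∧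
            (V a lam)ᴴ * V a lam = (k : ℂ) • (1 : Matrix (Fin k) (Fin k) ℂ) := by
  have htree := h.ae_isPerfectTree hΩ
  have hcard := ae_restrict_of_ae (s := fundDomain M) hΩ.encard_latticeAt
  -- Comparing two counts of `Λ_x` at one good point gives `k = ∏ l, q l`, hence a labelling `J`
  -- chosen before `x`.
  obtain ⟨x₀, hx₀, hx₀'⟩ := exists_of_ae_fundDomain hM (htree.and hcard)
  have hk : k = ∏ l, q l := by
    rw [hx₀.encard_eq] at hx₀'
    exact_mod_cast hx₀'.symm
  have hJ : Nonempty (Fin k ≃ ((l : Fin d) → Fin (q l))) := by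
    rw [← Fintype.card_eq]
    simpa using hk
  obtain ⟨J⟩ := hJ
  let a : Fin k → Fin d → ℝ := fun s l => v l / (q l : ℝ) * ((J s l : ℕ) : ℝ) + η l
  have ha : ∀ s l, a s l = v l / (q l : ℝ) * ((J s l : ℕ) : ℝ) + η l := fun _ _ => rfl
  have hmatrix : ∀ x, IsPerfectTree (latticeAt M Ω x) v q →
      ∀ lam : Fin k → Fin d → ℝ, Function.Injective lam → Set.range lam = latticeAt M Ω x →
        (∃ σ : Fin k ≃ ((l : Fin d) → Fin (q l)),
          Matrix.reindex J σ (V a lam) = kroneckerProd (fun l => dft (q l))) ∧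
        (V a lam)ᴴ * V a lam = (k : ℂ) • (1 : Matrix (Fin k) (Fin k) ℂ) := by
    intro x hx lam hinj hrange
    obtain ⟨σ, hσ⟩ := hx.exists_reindex_V hM (fun _ hy => hy.1) hη J ha hinj hrange
    exact ⟨⟨σ, hσ⟩, conjTranspose_mul_self_of_reindex_eq hσ⟩
  have hV : ∀ᵐ x ∂(volume.restrict (fundDomain M)), ∃ lam : Fin k → Fin d → ℝ,
      Function.Injective lam ∧ Set.range lam = latticeAt M Ω x ∧
      (V a lam)ᴴ * V a lam = (k : ℂ) • (1 : Matrix (Fin k) (Fin k) ℂ) := by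
    filter_upwards [htree] with x hx
    obtain ⟨L, hL, hLS, -⟩ := hx.exists_parametrization
    have hinj : Function.Injective (L ∘ J) := hL.comp J.injective
    have hrange : Set.range (L ∘ J) = latticeAt M Ω x := by
      rw [J.surjective.range_comp, hLS]
    exact ⟨L ∘ J, hinj, hrange, (hmatrix x hx _ hinj hrange).2⟩
  refine ⟨a, J, ha, ?_, ?_, hΩ.isOrthogonalBasisOfExponentials hM hV, ?_⟩
  · filter_upwards [htree] with x hx using hx.range_eq_shiftSet J ha
  · obtain ⟨x, lam, -, hrange, hVV⟩ := exists_of_ae_fundDomain hM hV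
    intro s t hst
    refine sub_notMem_dualLattice hM hΩ.ne_zero (fun r => ?_) hVV hst
    exact (show lam r ∈ latticeAt M Ω x from hrange ▸ ⟨r, rfl⟩).1
  · filter_upwards [htree, hcard] with x hx hx'
    refine ⟨hx', fun l p hp => ?_, hmatrix x hx⟩
    obtain ⟨z, hz, hzr, hzt⟩ := hx.exists_children l hp
    exact ⟨z, hz, hzr, W_eq_dft hzt⟩

end

end MultiTile

end

theorem mainTheorem4 {d : ℕ} (M : Matrix (Fin d) (Fin d) ℝ) (hM : M.det ≠ 0) (k : ℕ)
    (Ω : Set (Fin d → ℝ)) (hΩ : MultiTile.IsKTile M k Ω) :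
    (MultiTile.IsPerfectlyAdmissible M Ω →
      ∃ a : Fin k → Fin d → ℝ,
        (∀ s t, s ≠ t → a s - a t ∉ MultiTile.dualLattice M) ∧
        MultiTile.IsOrthogonalBasisOfExponentials Ω (MultiTile.frequencies M a)) ∧
    ∀ (v : Fin d → ℝ) (q : Fin d → ℕ), MultiTile.IsPerfectlyAdmissibleWith M Ω v q →
      ∀ η ∈ MultiTile.dualLattice M,
        ∃ (a : Fin k → Fin d → ℝ) (J : Fin k ≃ ((l : Fin d) → Fin (q l))),
          (∀ s l, a s l = v l / (q l : ℝ) * (((J s l : Fin (q l)) : ℕ) : ℝ) + η l) ∧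
          (∀ᵐ x ∂(volume.restrict (MultiTile.fundDomain M)),
            Set.range a = MultiTile.shiftSet v q η (MultiTile.latticeAt M Ω x)) ∧
          (∀ s t, s ≠ t → a s - a t ∉ MultiTile.dualLattice M) ∧
          MultiTile.IsOrthogonalBasisOfExponentials Ω (MultiTile.frequencies M a) ∧
          ∀ᵐ x ∂(volume.restrict (MultiTile.fundDomain M)),
            (MultiTile.latticeAt M Ω x).encard = (k : ℕ∞) ∧
            (∀ l : Fin d,
              ∀ p ∈ MultiTile.truncate (MultiTile.latticeAt M Ω x) (l : ℕ) l.isLt.le,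
                ∃ z : Fin (q l) → ℝ, Function.Injective z ∧
                  Set.range z = MultiTile.levelSet (MultiTile.latticeAt M Ω x) l p ∧
                  MultiTile.W (v l / (q l : ℝ)) z = MultiTile.dft (q l)) ∧
            ∀ lam : Fin k → Fin d → ℝ, Function.Injective lam →
              Set.range lam = MultiTile.latticeAt M Ω x →
                (∃ σ : Fin k ≃ ((l : Fin d) → Fin (q l)),
                  Matrix.reindex J σ (MultiTile.V a lam) =
                    MultiTile.kroneckerProd (fun l => MultiTile.dft (q l))) ∧
                (MultiTile.V a lam)ᴴ * MultiTile.V a lam =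
                  (k : ℂ) • (1 : Matrix (Fin k) (Fin k) ℂ) := by
  refine ⟨?_, fun v q h η hη => MultiTile.exists_shifts hM hΩ h hη⟩
  rintro ⟨v, q, h⟩
  -- Part (a) is the case `η = 0`, for any witnesses.
  obtain ⟨a, -, -, -, ha, hbasis, -⟩ := MultiTile.exists_shifts (η := 0) hM hΩ h
    ⟨0, by simp [← Pi.zero_def]⟩
  exact ⟨a, ha, hbasis⟩
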